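/- Let $r\ge 1$, let $A$ be a finite set, and let $M_1,\dots,M_r$ be matrices with rows and columns indexed by $A$, with entries $M_j(b,a)$ ($a,b\in A$). For $m\in\mathbb{Z}_+^r$ let $[0,m]=\{l\in\mathbb{Z}^r: 0\le l\le m\}$, and let $W_m$ be the set of words of shape $m$, i.e. of maps $w:[0,m]\to A$ with $M_j(w(l+e_j),w(l))=1$ whenever $l,l+e_j\in[0,m]$. Put $o(w)=w(0)$, $t(w)=w(m)$ and $W=\bigcup_m W_m$. If $k,l\ge 0$ and $k+l\le m$, let $w|_{[k,k+l]}\in W_l$ be the word $i\mapsto w(k+i)$. For $0\neq p\in\mathbb{Z}^r$, a word $w\in W_l$ is called $p$-periodic if $w(x-p)=w(x)$ for all $x\in[0,l]\cap[p,p+l]$. Assume: (H0) each $M_i$ is a nonzero $\{0,1\}$-matrix; (H1) if $u\in W_m$, $v\in W_n$ and $t(u)=o(v)$, there is a unique $w\in W_{m+n}$, denoted $uv$, with $w|_{[0,m]}=u$ and $w|_{[m,m+n]}=v$; (H2) the directed graph with vertex set $A$ and an edge from $a$ to $b$ for each $i$ with $M_i(b,a)=1$ is irreducible, i.e. there is a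 directed path from any vertex to any other; (H3) for every $0\ne p\in\mathbb{Z}^r$ there is a word $w\in W$ that is not $p$-periodic. Let $D$ be a nonempty finite or countable set with a map $\delta:D\to A$. A decorated word of shape $m$ is a pair $(d,w)\in D\times W_m$ with $o(w)=\delta(d)$; put $t(d,w)=t(w)$ and $(d,w)w'=(d,ww')$ when $t(w)=o(w')$. Write $\overline W_m$ for the set of decorated words of shape $m$ and $\overline W=\bigcup_m\overline W_m$. Let $\mathcal{A}$ be the universal $C^*$-algebra generated by partial isometries $s_{u,v}$, for $u,v\in\overline W$ with $t(u)=t(v)$, subject to the relations $$s_{u,v}^*=s_{v,u},\qquad s_{u,v}s_{v,w}=s_{u,w},\qquad s_{u,v}=\sum_{w\in W_{e_j},\ o(w)=t(u)=t(v)}s_{uw,vw}\quad(1\le j\le r),$$ $$s_{u,u}s_{v,v}=0\quad\text{for } u,v\in\overline W_0,\ u\neq v.$$ (That is, $\mathcal{A}$ is the enveloping $C^*$-algebra of the complex $*$-algebra with these generators and relations.) Then $\mathcal{A}$ is purely infinite: for every nonzero positive $h\in\mathcal{A}$, the hereditary $C^*$-subalgebra $\overline{h\mathcal{A}h}$ generated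 by $h$ contains an infinite projection, i.e. a projection $p$ for which there is $v\in\mathcal{A}$ with $v^*v=p$ and $vv^*<p$. -/

import Mathlib

open UniformSpace

/-! ### Higher rank words -/

section Words

variable {r : ℕ} {A : Type*}

/-- `Word M m` is the set `W_m` of words of shape `m ∈ ℕ^r`: functions `w : [0, m] → A` such that
`M j (w (l + e_j)) (w l) = 1` whenever `l` and `l + e_j` both lie in `[0, m]`. -/
@[ext]
structure Word (M : Fin r → Matrix A A ℤ) (m : Fin r → ℕ) where
  toFun : Set.Iic m → A
  adm : ∀ (j : Fin r) (l l' : Set.Iic m), (l' : Fin r → ℕ) = (l : Fin r → ℕ) + Pi.single j 1 →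
    M j (toFun l') (toFun l) = 1

namespace Word

variable {M : Fin r → Matrix A A ℤ} {m : Fin r → ℕ}

/-- The origin `o(w) = w(0)`. -/
def o (w : Word M m) : A := w.toFun ⟨0, fun _ => Nat.zero_le _⟩

/-- The terminus `t(w) = w(m)`. -/
def t (w : Word M m) : A := w.toFun ⟨m, le_refl m⟩

/-- The restriction `w|_[k, k + l]`, translated back to the origin so that it has shape `l`. -/
def sub (w : Word M m) (k l : Fin r → ℕ) (h : k + l ≤ m) : Word M l where
  toFun i := w.toFun ⟨k + i, le_trans (add_le_add_right i.2 k) h⟩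
  adm j i i' hi := w.adm j _ _ (by
    show k + (i' : Fin r → ℕ) = k + (i : Fin r → ℕ) + Pi.single j 1
    rw [hi, add_assoc])

/-- `w ∈ W_l` is `p`-periodic (for `p ∈ ℤ^r`) if `w` and its translate `τ_p w` agree on
`[0, l] ∩ [p, p + l]`. -/
def IsPeriodic (w : Word M m) (p : Fin r → ℤ) : Prop :=
  ∀ i j : Set.Iic m, (∀ k, ((j : Fin r → ℕ) k : ℤ) = p k + ((i : Fin r → ℕ) k : ℤ)) →
    w.toFun i = w.toFun j

instance [Finite A] : Finite (Word M m) := by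
  have : Finite (Set.Iic m) := (Set.finite_Iic m).to_subtype
  exact Finite.of_injective Word.toFun fun _ _ h => Word.ext h

end Word

/-- (H0): each `M i` is a nonzero `{0,1}`-matrix. -/
def CondH0 (M : Fin r → Matrix A A ℤ) : Prop :=
  ∀ i, M i ≠ 0 ∧ ∀ a b, M i b a = 0 ∨ M i b a = 1

/-- (H1): if `u ∈ W_m`, `v ∈ W_n` and `t(u) = o(v)`, there is a unique `w ∈ W_{m+n}` with
`w|_[0,m] = u` and `w|_[m,m+n] = v`. -/
def CondH1 (M : Fin r → Matrix A A ℤ) : Prop :=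
  ∀ (m n : Fin r → ℕ) (u : Word M m) (v : Word M n), u.t = v.o →
    ∃! w : Word M (m + n),
      w.sub 0 m (by rw [zero_add]; exact le_self_add) = u ∧ w.sub m n le_rfl = v

/-- (H2): the directed graph on `A` with an edge from `a` to `b` for each `i` with `M i b a = 1`
is irreducible: there is a directed path from every vertex to every vertex. -/
def CondH2 (M : Fin r → Matrix A A ℤ) : Prop :=
  ∀ a b : A, Relation.ReflTransGen (fun a b => ∃ i, M i b a = 1) a b

/-- (H3): for every nonzero `p ∈ ℤ^r` some word is not `p`-periodic. -/
def CondH3 (M : Fin r → Matrix A A ℤ) : Prop :=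
  ∀ p : Fin r → ℤ, p ≠ 0 → ∃ (m : Fin r → ℕ) (w : Word M m), ¬ w.IsPeriodic p

/-- The set of decorated words `(d, w)`, `o(w) = δ(d)`, of arbitrary shape. -/
structure DWord {D : Type*} (M : Fin r → Matrix A A ℤ) (δ : D → A) where
  shape : Fin r → ℕ
  deco : D
  word : Word M shape
  o_eq : word.o = δ deco

variable {D : Type*} {M : Fin r → Matrix A A ℤ} {δ : D → A}

/-- The product `uv` of words given by (H1). -/
noncomputable def Word.mul (h1 : CondH1 M) {m n : Fin r → ℕ} (u : Word M m) (v : Word M n)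
    (h : u.t = v.o) : Word M (m + n) := (h1 m n u v h).choose

theorem Word.mul_sub_left (h1 : CondH1 M) {m n : Fin r → ℕ} (u : Word M m) (v : Word M n)
    (h : u.t = v.o) :
    (Word.mul h1 u v h).sub 0 m (by rw [zero_add]; exact le_self_add) = u :=
  (h1 m n u v h).choose_spec.1.1

theorem Word.mul_sub_right (h1 : CondH1 M) {m n : Fin r → ℕ} (u : Word M m) (v : Word M n)
    (h : u.t = v.o) : (Word.mul h1 u v h).sub m n le_rfl = v :=
  (h1 m n u v h).choose_spec.1.2

theorem Word.mul_o (h1 : CondH1 M) {m n : Fin r → ℕ} (u : Word M m) (v : Word M n)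
    (h : u.t = v.o) : (Word.mul h1 u v h).o = u.o :=
  (congrArg Word.o (Word.mul_sub_left h1 u v h) :)

theorem Word.mul_t (h1 : CondH1 M) {m n : Fin r → ℕ} (u : Word M m) (v : Word M n)
    (h : u.t = v.o) : (Word.mul h1 u v h).t = v.t :=
  (congrArg Word.t (Word.mul_sub_right h1 u v h) :)

/-- The terminus of a decorated word. -/
def DWord.t (u : DWord M δ) : A := u.word.t

/-- The product `(d, u) w = (d, u w)` of a decorated word and a word. -/
noncomputable def DWord.mul (h1 : CondH1 M) (u : DWord M δ) {n : Fin r → ℕ} (w : Word M n)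
    (h : u.t = w.o) : DWord M δ where
  shape := u.shape + n
  deco := u.deco
  word := u.word.mul h1 w h
  o_eq := (Word.mul_o h1 u.word w h).trans u.o_eq

theorem DWord.mul_t (h1 : CondH1 M) (u : DWord M δ) {n : Fin r → ℕ} (w : Word M n)
    (h : u.t = w.o) : (u.mul h1 w h).t = w.t :=
  Word.mul_t h1 u.word w h

end Words

/-! ### The `*`-algebra given by generators and relations -/

section Algebra0

variable {r : ℕ} {A D : Type*}

/-- Formal expressions in the generators `s_{u,v}` (`t(u) = t(v)`) with the operations of a
(not necessarily unital) complex algebra. -/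
inductive PreAlg (M : Fin r → Matrix A A ℤ) (δ : D → A) where
  | gen (u v : DWord M δ) (h : u.t = v.t) : PreAlg M δ
  | zero : PreAlg M δ
  | add : PreAlg M δ → PreAlg M δ → PreAlg M δ
  | smul : ℂ → PreAlg M δ → PreAlg M δ
  | mul : PreAlg M δ → PreAlg M δ → PreAlg M δ

variable {M : Fin r → Matrix A A ℤ} {δ : D → A}

namespace PreAlg

/-- The formal sum of a list of expressions. -/
def sum (L : List (PreAlg M δ)) : PreAlg M δ := L.foldr add zero

/-- The antilinear antiautomorphism with `s_{u,v}* = s_{v,u}`, on expressions. -/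
def conj : PreAlg M δ → PreAlg M δ
  | gen u v h => gen v u h.symm
  | zero => zero
  | add x y => add (conj x) (conj y)
  | smul c x => smul (star c) (conj x)
  | mul x y => mul (conj y) (conj x)

theorem conj_conj (x : PreAlg M δ) : conj (conj x) = x := by
  induction x <;> simp_all [conj]

theorem conj_sum (L : List (PreAlg M δ)) : conj (sum L) = sum (L.map conj) := by
  induction L with
  | nil => rfl
  | cons x L ih => exact congrArg (add (conj x)) ih

variable [Finite A]

/-- The formal sum `∑ s_{uw,vw}` over all words `w` of shape `e_j` with `o(w) = a`, where
`a = t(u) = t(v)`. -/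
noncomputable def extSum (h1 : CondH1 M) (j : Fin r) (a : A) (u v : DWord M δ)
    (hu : u.t = a) (hv : v.t = a) : PreAlg M δ :=
  letI : Fintype {w : Word M (Pi.single j 1) // w.o = a} := Fintype.ofFinite _
  sum ((Finset.univ : Finset {w : Word M (Pi.single j 1) // w.o = a}).toList.map fun w =>
    gen (u.mul h1 w.1 (hu.trans w.2.symm)) (v.mul h1 w.1 (hv.trans w.2.symm))
      ((u.mul_t h1 _ _).trans (v.mul_t h1 _ _).symm))

/-- The congruence on expressions generated by the axioms of complex algebras and by the
relations `s_{u,v} s_{v,w} = s_{u,w}`, `s_{u,v} = ∑ s_{uw,vw}` and `s_{u,u} s_{v,v} = 0` for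
distinct decorated words `u, v` of shape `0`. -/
inductive Rel (h1 : CondH1 M) : PreAlg M δ → PreAlg M δ → Prop
  -- congruence
  | refl (x) : Rel h1 x x
  | symm {x y} : Rel h1 x y → Rel h1 y x
  | trans {x y z} : Rel h1 x y → Rel h1 y z → Rel h1 x z
  | add_congr {x x' y y'} : Rel h1 x x' → Rel h1 y y' → Rel h1 (add x y) (add x' y')
  | smul_congr (c : ℂ) {x x'} : Rel h1 x x' → Rel h1 (smul c x) (smul c x')
  | mul_congr {x x' y y'} : Rel h1 x x' → Rel h1 y y' → Rel h1 (mul x y) (mul x' y')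
  -- vector space axioms
  | add_assoc (x y z) : Rel h1 (add (add x y) z) (add x (add y z))
  | add_comm (x y) : Rel h1 (add x y) (add y x)
  | zero_add (x) : Rel h1 (add zero x) x
  | smul_add (c : ℂ) (x y) : Rel h1 (smul c (add x y)) (add (smul c x) (smul c y))
  | add_smul (c d : ℂ) (x) : Rel h1 (smul (c + d) x) (add (smul c x) (smul d x))
  | mul_smul (c d : ℂ) (x) : Rel h1 (smul (c * d) x) (smul c (smul d x))
  | one_smul (x) : Rel h1 (smul 1 x) x
  | zero_smul (x) : Rel h1 (smul 0 x) zero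
  -- algebra axioms
  | mul_assoc (x y z) : Rel h1 (mul (mul x y) z) (mul x (mul y z))
  | left_distrib (x y z) : Rel h1 (mul x (add y z)) (add (mul x y) (mul x z))
  | right_distrib (x y z) : Rel h1 (mul (add x y) z) (add (mul x z) (mul y z))
  | smul_mul (c : ℂ) (x y) : Rel h1 (mul (smul c x) y) (smul c (mul x y))
  | mul_smul_comm (c : ℂ) (x y) : Rel h1 (mul x (smul c y)) (smul c (mul x y))
  -- the defining relations
  | gen_mul (u v w : DWord M δ) (h : u.t = v.t) (h' : v.t = w.t) :
      Rel h1 (mul (gen u v h) (gen v w h')) (gen u w (h.trans h'))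
  | gen_ext (j : Fin r) (a : A) (u v : DWord M δ) (hu : u.t = a) (hv : v.t = a) :
      Rel h1 (gen u v (hu.trans hv.symm)) (extSum h1 j a u v hu hv)
  | gen_orth (u v : DWord M δ) (hu : u.shape = 0) (hv : v.shape = 0) (h : u ≠ v) :
      Rel h1 (mul (gen u u rfl) (gen v v rfl)) zero

theorem conj_extSum (h1 : CondH1 M) (j : Fin r) (a : A) (u v : DWord M δ)
    (hu : u.t = a) (hv : v.t = a) :
    conj (extSum h1 j a u v hu hv) = extSum h1 j a v u hv hu := by
  unfold extSum
  rw [conj_sum, List.map_map]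
  rfl

theorem Rel.conj {h1 : CondH1 M} {x y : PreAlg M δ} (h : Rel h1 x y) :
    Rel h1 x.conj y.conj := by
  induction h with
  | refl x => exact .refl _
  | symm _ ih => exact ih.symm
  | trans _ _ ih ih' => exact ih.trans ih'
  | add_congr _ _ ih ih' => exact .add_congr ih ih'
  | smul_congr c _ ih => exact .smul_congr _ ih
  | mul_congr _ _ ih ih' => exact .mul_congr ih' ih
  | add_assoc => exact .add_assoc _ _ _
  | add_comm => exact .add_comm _ _
  | zero_add => exact .zero_add _
  | smul_add => exact .smul_add _ _ _
  | add_smul c d x => simp only [PreAlg.conj, star_add]; exact .add_smul _ _ _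
  | mul_smul c d x => simp only [PreAlg.conj, StarMul.star_mul, mul_comm (star d)]; exact .mul_smul _ _ _
  | one_smul => simp only [PreAlg.conj, star_one]; exact .one_smul _
  | zero_smul => simp only [PreAlg.conj, star_zero]; exact .zero_smul _
  | mul_assoc => exact (Rel.mul_assoc _ _ _).symm
  | left_distrib => exact .right_distrib _ _ _
  | right_distrib => exact .left_distrib _ _ _
  | smul_mul => exact .mul_smul_comm _ _ _
  | mul_smul_comm => exact .smul_mul _ _ _
  | gen_mul => exact .gen_mul _ _ _ _ _
  | gen_ext => rw [conj_extSum]; exact .gen_ext _ _ _ _ _ _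
  | gen_orth u v hu hv h => exact .gen_orth _ _ hv hu h.symm

end PreAlg

variable [Finite A]

/-- The `*`-algebra `𝒜₀` over `ℂ` with generators `s_{u,v}` and the defining relations. -/
def Alg0 (M : Fin r → Matrix A A ℤ) (δ : D → A) (h1 : CondH1 M) : Type _ :=
  Quot (PreAlg.Rel (δ := δ) h1)

namespace Alg0

open PreAlg

variable {h1 : CondH1 M}

/-- The generators of `𝒜₀`. -/
def gen (h1 : CondH1 M) (u v : DWord M δ) (h : u.t = v.t) : Alg0 M δ h1 :=
  Quot.mk _ (PreAlg.gen u v h)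

instance : Zero (Alg0 M δ h1) := ⟨Quot.mk _ PreAlg.zero⟩

instance : Add (Alg0 M δ h1) :=
  ⟨Quot.map₂ PreAlg.add (fun _ _ _ h => .add_congr (.refl _) h)
    (fun _ _ _ h => .add_congr h (.refl _))⟩

instance : Mul (Alg0 M δ h1) :=
  ⟨Quot.map₂ PreAlg.mul (fun _ _ _ h => .mul_congr (.refl _) h)
    (fun _ _ _ h => .mul_congr h (.refl _))⟩

instance : SMul ℂ (Alg0 M δ h1) :=
  ⟨fun c => Quot.map (PreAlg.smul c) (fun _ _ h => .smul_congr c h)⟩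

instance : Star (Alg0 M δ h1) := ⟨Quot.map PreAlg.conj (fun _ _ h => h.conj)⟩

instance : Neg (Alg0 M δ h1) := ⟨fun x => (-1 : ℂ) • x⟩

instance : AddCommMonoid (Alg0 M δ h1) where
  add_assoc := by rintro ⟨x⟩ ⟨y⟩ ⟨z⟩; exact Quot.sound (.add_assoc _ _ _)
  zero_add := by rintro ⟨x⟩; exact Quot.sound (.zero_add _)
  add_zero := by rintro ⟨x⟩; exact Quot.sound ((Rel.add_comm _ _).trans (.zero_add _))
  add_comm := by rintro ⟨x⟩ ⟨y⟩; exact Quot.sound (.add_comm _ _)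
  nsmul := nsmulRec

private theorem smul_zero' (c : ℂ) : c • (0 : Alg0 M δ h1) = 0 :=
  Quot.sound (((Rel.smul_congr c (Rel.zero_smul PreAlg.zero).symm).trans
    (Rel.mul_smul c 0 _).symm).trans (by rw [mul_zero]; exact .zero_smul _))

instance : Module ℂ (Alg0 M δ h1) where
  one_smul := by rintro ⟨x⟩; exact Quot.sound (.one_smul _)
  mul_smul := by rintro c d ⟨x⟩; exact Quot.sound (.mul_smul _ _ _)
  smul_zero := smul_zero'
  smul_add := by rintro c ⟨x⟩ ⟨y⟩; exact Quot.sound (.smul_add _ _ _)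
  add_smul := by rintro c d ⟨x⟩; exact Quot.sound (.add_smul _ _ _)
  zero_smul := by rintro ⟨x⟩; exact Quot.sound (.zero_smul _)

instance : IsScalarTower ℂ (Alg0 M δ h1) (Alg0 M δ h1) :=
  ⟨by rintro c ⟨x⟩ ⟨y⟩; exact Quot.sound (.smul_mul _ _ _)⟩

instance : SMulCommClass ℂ (Alg0 M δ h1) (Alg0 M δ h1) :=
  ⟨by rintro c ⟨x⟩ ⟨y⟩; exact Quot.sound (Rel.mul_smul_comm _ _ _).symm⟩

instance : NonUnitalRing (Alg0 M δ h1) where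
  neg_add_cancel x := by
    show (-1 : ℂ) • x + x = 0
    nth_rw 2 [← one_smul ℂ x]
    rw [← add_smul, neg_add_cancel, zero_smul]
  zsmul := zsmulRec
  mul_assoc := by rintro ⟨x⟩ ⟨y⟩ ⟨z⟩; exact Quot.sound (.mul_assoc _ _ _)
  left_distrib := by rintro ⟨x⟩ ⟨y⟩ ⟨z⟩; exact Quot.sound (.left_distrib _ _ _)
  right_distrib := by rintro ⟨x⟩ ⟨y⟩ ⟨z⟩; exact Quot.sound (.right_distrib _ _ _)
  zero_mul x := by
    have h := smul_mul_assoc (0 : ℂ) (0 : Alg0 M δ h1) x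
    rwa [zero_smul, zero_smul] at h
  mul_zero x := by
    have h := mul_smul_comm (0 : ℂ) x (0 : Alg0 M δ h1)
    rwa [zero_smul, zero_smul] at h

instance : StarRing (Alg0 M δ h1) where
  star_involutive := by rintro ⟨x⟩; exact congrArg (Quot.mk _) (conj_conj x)
  star_mul := by rintro ⟨x⟩ ⟨y⟩; rfl
  star_add := by rintro ⟨x⟩ ⟨y⟩; rfl

instance : StarModule ℂ (Alg0 M δ h1) := ⟨by rintro c ⟨x⟩; rfl⟩

theorem star_gen (u v : DWord M δ) (h : u.t = v.t) : star (gen h1 u v h) = gen h1 v u h.symm := rfl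

theorem gen_mul_gen (u v w : DWord M δ) (h : u.t = v.t) (h' : v.t = w.t) :
    gen h1 u v h * gen h1 v w h' = gen h1 u w (h.trans h') := Quot.sound (.gen_mul _ _ _ _ _)

end Alg0

end Algebra0

/-! ### Enveloping `C*`-algebras -/

section Enveloping

/-- A `C*`-seminorm on a complex `*`-algebra. -/
structure CStarSeminorm (B : Type*) [NonUnitalRing B] [StarRing B] [Module ℂ B]
    extends Seminorm ℂ B where
  mul_le' : ∀ x y, toSeminorm (x * y) ≤ toSeminorm x * toSeminorm y
  star_mul_self' : ∀ x, toSeminorm (star x * x) = toSeminorm x ^ 2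

/-- A `*`-algebra has an enveloping `C*`-algebra if its `C*`-seminorms are pointwise bounded. -/
class BddCStarSeminorms (B : Type*) [NonUnitalRing B] [StarRing B] [Module ℂ B] : Prop where
  bdd : ∀ x : B, BddAbove (Set.range fun p : CStarSeminorm B => p.toSeminorm x)

variable (B : Type*) [NonUnitalRing B] [StarRing B] [Module ℂ B]

/-- A copy of the `*`-algebra `B`, to be endowed with the largest `C*`-seminorm on `B`. -/
def PreEnvelope : Type _ := B

variable {B} in
/-- The largest `C*`-seminorm on `B`: the supremum of all `C*`-seminorms. -/
noncomputable def maxCStarSeminorm (x : B) : ℝ := ⨆ p : CStarSeminorm B, p.toSeminorm x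

namespace PreEnvelope

instance : NonUnitalRing (PreEnvelope B) := inferInstanceAs (NonUnitalRing B)
instance : StarRing (PreEnvelope B) := inferInstanceAs (StarRing B)
instance : Module ℂ (PreEnvelope B) := inferInstanceAs (Module ℂ B)
instance [StarModule ℂ B] : StarModule ℂ (PreEnvelope B) := inferInstanceAs (StarModule ℂ B)
instance [IsScalarTower ℂ B B] : IsScalarTower ℂ (PreEnvelope B) (PreEnvelope B) :=
  inferInstanceAs (IsScalarTower ℂ B B)
instance [SMulCommClass ℂ B B] : SMulCommClass ℂ (PreEnvelope B) (PreEnvelope B) :=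
  inferInstanceAs (SMulCommClass ℂ B B)

end PreEnvelope

variable {B}

instance : Nonempty (CStarSeminorm B) :=
  ⟨{  toSeminorm := 0
      mul_le' := fun _ _ => by simp
      star_mul_self' := fun _ => by simp }⟩

theorem CStarSeminorm.star_eq (p : CStarSeminorm B) (x : B) :
    p.toSeminorm (star x) = p.toSeminorm x := by
  have key : ∀ y : B, p.toSeminorm y ≤ p.toSeminorm (star y) := by
    intro y
    have h1 : p.toSeminorm y ^ 2 ≤ p.toSeminorm (star y) * p.toSeminorm y :=
      (p.star_mul_self' y).symm.le.trans (p.mul_le' _ _)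
    rcases (apply_nonneg p.toSeminorm y).eq_or_lt with h | h
    · rw [← h]; exact apply_nonneg _ _
    · exact le_of_mul_le_mul_right (by rwa [← sq]) h
  exact le_antisymm (by simpa using key (star x)) (key x)

theorem maxCStarSeminorm_nonneg (x : B) : 0 ≤ maxCStarSeminorm x :=
  Real.iSup_nonneg fun _ => apply_nonneg _ _

theorem maxCStarSeminorm_star (x : B) : maxCStarSeminorm (star x) = maxCStarSeminorm x := by
  simp only [maxCStarSeminorm, CStarSeminorm.star_eq]

variable [BddCStarSeminorms B]

theorem CStarSeminorm.le_max (p : CStarSeminorm B) (x : B) :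
    p.toSeminorm x ≤ maxCStarSeminorm x :=
  le_ciSup (BddCStarSeminorms.bdd x) p

theorem maxCStarSeminorm_star_mul_self (x : B) :
    maxCStarSeminorm (star x * x) = maxCStarSeminorm x * maxCStarSeminorm x := by
  apply le_antisymm
  · refine ciSup_le fun p => ?_
    rw [← sq]
    exact (p.star_mul_self' x).le.trans
      (pow_le_pow_left₀ (apply_nonneg _ _) (p.le_max x) 2)
  · have h : maxCStarSeminorm x ≤ √(maxCStarSeminorm (star x * x)) :=
      ciSup_le fun p => Real.le_sqrt_of_sq_le
        ((p.star_mul_self' x).symm.le.trans (p.le_max (star x * x)))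
    calc _ ≤ √(maxCStarSeminorm (star x * x)) * √(maxCStarSeminorm (star x * x)) :=
          mul_self_le_mul_self (maxCStarSeminorm_nonneg x) h
      _ = _ := Real.mul_self_sqrt (maxCStarSeminorm_nonneg _)

theorem maxCStarSeminorm_mul_le (x y : B) :
    maxCStarSeminorm (x * y) ≤ maxCStarSeminorm x * maxCStarSeminorm y :=
  ciSup_le fun p => (p.mul_le' x y).trans
    (mul_le_mul (p.le_max x) (p.le_max y) (apply_nonneg _ _) (maxCStarSeminorm_nonneg x))

theorem maxCStarSeminorm_add_le (x y : B) :
    maxCStarSeminorm (x + y) ≤ maxCStarSeminorm x + maxCStarSeminorm y :=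
  ciSup_le fun p => (map_add_le_add p.toSeminorm x y).trans (add_le_add (p.le_max x) (p.le_max y))

theorem maxCStarSeminorm_smul_le (c : ℂ) (x : B) :
    maxCStarSeminorm (c • x) ≤ ‖c‖ * maxCStarSeminorm x :=
  ciSup_le fun p => (map_smul_eq_mul p.toSeminorm c x).le.trans
    (mul_le_mul_of_nonneg_left (p.le_max x) (norm_nonneg c))

variable (B) in
/-- `maxCStarSeminorm` as an additive group seminorm. -/
noncomputable def maxCStarAddSeminorm : AddGroupSeminorm B where
  toFun := maxCStarSeminorm
  map_zero' := by simp [maxCStarSeminorm]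
  add_le' := maxCStarSeminorm_add_le
  neg' x := by simp [maxCStarSeminorm]

namespace PreEnvelope

noncomputable instance : SeminormedAddCommGroup (PreEnvelope B) :=
  AddGroupSeminorm.toSeminormedAddCommGroup (maxCStarAddSeminorm B)

noncomputable instance : NonUnitalSeminormedRing (PreEnvelope B) where
  __ := (inferInstance : SeminormedAddCommGroup (PreEnvelope B))
  __ := (inferInstance : NonUnitalRing (PreEnvelope B))
  norm_mul_le := maxCStarSeminorm_mul_le (B := B)

noncomputable instance : NormedSpace ℂ (PreEnvelope B) where
  norm_smul_le := maxCStarSeminorm_smul_le (B := B)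

instance : NormedStarGroup (PreEnvelope B) where
  norm_star_le x := (maxCStarSeminorm_star (B := B) x).le

theorem norm_star_mul_self (x : PreEnvelope B) : ‖star x * x‖ = ‖x‖ * ‖x‖ :=
  maxCStarSeminorm_star_mul_self (B := B) x

theorem uniformContinuous_star : UniformContinuous (star : PreEnvelope B → PreEnvelope B) :=
  star_isometry.uniformContinuous

end PreEnvelope

variable (B) in
/-- The enveloping `C*`-algebra of `B`: the Hausdorff completion of `B` with respect to the
largest `C*`-seminorm. -/
def EnvelopingCStarAlgebra : Type _ := Completion (PreEnvelope B)

namespace EnvelopingCStarAlgebra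

noncomputable instance : NormedAddCommGroup (EnvelopingCStarAlgebra B) :=
  inferInstanceAs (NormedAddCommGroup (Completion (PreEnvelope B)))

noncomputable instance : NormedSpace ℂ (EnvelopingCStarAlgebra B) :=
  inferInstanceAs (NormedSpace ℂ (Completion (PreEnvelope B)))

instance : CompleteSpace (EnvelopingCStarAlgebra B) :=
  inferInstanceAs (CompleteSpace (Completion (PreEnvelope B)))

/-- The canonical map from `B` to its enveloping `C*`-algebra. -/
noncomputable def ofPre (x : PreEnvelope B) : EnvelopingCStarAlgebra B := (x : Completion (PreEnvelope B))

theorem isDenseInducing_ofPre : IsDenseInducing (ofPre : PreEnvelope B → _) :=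
  Completion.isDenseInducing_coe

theorem continuous_ofPre : Continuous (ofPre : PreEnvelope B → _) :=
  Completion.continuous_coe _

theorem norm_ofPre (x : PreEnvelope B) : ‖ofPre x‖ = ‖x‖ := Completion.norm_coe x

theorem ofPre_add (x y : PreEnvelope B) : ofPre (x + y) = ofPre x + ofPre y :=
  Completion.coe_add x y

theorem ofPre_zero : ofPre (0 : PreEnvelope B) = 0 := rfl

theorem ofPre_smul (c : ℂ) (x : PreEnvelope B) : ofPre (c • x) = c • ofPre x :=
  Completion.coe_smul c x

noncomputable instance : Mul (EnvelopingCStarAlgebra B) :=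
  ⟨Function.curry <| (isDenseInducing_ofPre.prodMap isDenseInducing_ofPre).extend
    (ofPre ∘ Function.uncurry (· * ·))⟩

noncomputable instance : Star (EnvelopingCStarAlgebra B) :=
  ⟨Completion.map (star : PreEnvelope B → PreEnvelope B)⟩

theorem ofPre_mul (x y : PreEnvelope B) : ofPre (x * y) = ofPre x * ofPre y :=
  ((isDenseInducing_ofPre.prodMap isDenseInducing_ofPre).extend_eq
    (continuous_ofPre.comp continuous_mul) (x, y)).symm

theorem ofPre_star (x : PreEnvelope B) : ofPre (star x) = star (ofPre x) :=
  (Completion.map_coe PreEnvelope.uniformContinuous_star x).symm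

instance : ContinuousMul (EnvelopingCStarAlgebra B) where
  continuous_mul := by
    let e : PreEnvelope B →+ EnvelopingCStarAlgebra B := ⟨⟨ofPre, ofPre_zero⟩, ofPre_add⟩
    let m := (AddMonoidHom.mul : PreEnvelope B →+ PreEnvelope B →+ PreEnvelope B).compr₂ e
    have : Continuous fun p : PreEnvelope B × PreEnvelope B => m p.1 p.2 :=
      continuous_ofPre.comp continuous_mul
    have di : IsDenseInducing (e : PreEnvelope B → EnvelopingCStarAlgebra B) :=
      isDenseInducing_ofPre
    exact (di.extend_Z_bilin di this :)

instance : ContinuousStar (EnvelopingCStarAlgebra B) where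
  continuous_star := Completion.continuous_map

theorem ind {p : EnvelopingCStarAlgebra B → Prop} (hp : IsClosed {x | p x})
    (h : ∀ x, p (ofPre x)) (x) : p x := Completion.induction_on x hp h

theorem ind₂ {p : EnvelopingCStarAlgebra B → EnvelopingCStarAlgebra B → Prop}
    (hp : IsClosed {x : EnvelopingCStarAlgebra B × EnvelopingCStarAlgebra B | p x.1 x.2})
    (h : ∀ x y, p (ofPre x) (ofPre y)) (x y) : p x y := Completion.induction_on₂ x y hp h

theorem ind₃ {p : EnvelopingCStarAlgebra B → EnvelopingCStarAlgebra B →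
      EnvelopingCStarAlgebra B → Prop}
    (hp : IsClosed {x : EnvelopingCStarAlgebra B × EnvelopingCStarAlgebra B ×
      EnvelopingCStarAlgebra B | p x.1 x.2.1 x.2.2})
    (h : ∀ x y z, p (ofPre x) (ofPre y) (ofPre z)) (x y z) : p x y z :=
  Completion.induction_on₃ x y z hp h

noncomputable instance : NonUnitalNormedRing (EnvelopingCStarAlgebra B) where
  __ := (inferInstance : NormedAddCommGroup (EnvelopingCStarAlgebra B))
  zero_mul := ind (isClosed_eq (by fun_prop) (by fun_prop)) fun a => by
    rw [← ofPre_zero, ← ofPre_mul, zero_mul]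
  mul_zero := ind (isClosed_eq (by fun_prop) (by fun_prop)) fun a => by
    rw [← ofPre_zero, ← ofPre_mul, mul_zero]
  mul_assoc := ind₃ (isClosed_eq (by fun_prop) (by fun_prop)) fun a b c => by
    simp only [← ofPre_mul, mul_assoc]
  left_distrib := ind₃ (isClosed_eq (by fun_prop) (by fun_prop)) fun a b c => by
    simp only [← ofPre_mul, ← ofPre_add, mul_add]
  right_distrib := ind₃ (isClosed_eq (by fun_prop) (by fun_prop)) fun a b c => by
    simp only [← ofPre_mul, ← ofPre_add, add_mul]
  norm_mul_le := ind₂ (isClosed_le (by fun_prop) (by fun_prop)) fun a b => by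
    simp only [← ofPre_mul, norm_ofPre, norm_mul_le]

noncomputable instance : StarRing (EnvelopingCStarAlgebra B) where
  star_involutive := ind (isClosed_eq (by fun_prop) (by fun_prop)) fun a => by
    simp only [← ofPre_star, star_star]
  star_mul := ind₂ (isClosed_eq (by fun_prop) (by fun_prop)) fun a b => by
    simp only [← ofPre_star, ← ofPre_mul, star_mul]
  star_add := ind₂ (isClosed_eq (by fun_prop) (by fun_prop)) fun a b => by
    simp only [← ofPre_star, ← ofPre_add, star_add]

theorem smul_mul_env [IsScalarTower ℂ B B] (c : ℂ) :
    ∀ x y : EnvelopingCStarAlgebra B, (c • x) * y = c • (x * y) :=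
  ind₂ (isClosed_eq ((continuous_fst.const_smul c).mul continuous_snd)
    ((continuous_fst.mul continuous_snd).const_smul c)) fun a b => by
    rw [← ofPre_smul, ← ofPre_mul, ← ofPre_mul, ← ofPre_smul, smul_mul_assoc]

theorem mul_smul_env [SMulCommClass ℂ B B] (c : ℂ) :
    ∀ x y : EnvelopingCStarAlgebra B, x * (c • y) = c • (x * y) :=
  ind₂ (isClosed_eq (continuous_fst.mul (continuous_snd.const_smul c))
    ((continuous_fst.mul continuous_snd).const_smul c)) fun a b => by
    rw [← ofPre_smul, ← ofPre_mul, ← ofPre_mul, ← ofPre_smul, mul_smul_comm]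

theorem star_smul_env [StarModule ℂ B] (c : ℂ) :
    ∀ x : EnvelopingCStarAlgebra B, star (c • x) = star c • star x :=
  ind (isClosed_eq (continuous_id.const_smul c).star (continuous_id.star.const_smul (star c)))
    fun a => by rw [← ofPre_smul, ← ofPre_star, ← ofPre_star, ← ofPre_smul, star_smul]

/-- The enveloping `C*`-algebra is a `C*`-algebra. -/
noncomputable instance [StarModule ℂ B] [IsScalarTower ℂ B B] [SMulCommClass ℂ B B] :
    NonUnitalCStarAlgebra (EnvelopingCStarAlgebra B) where
  __ := (inferInstance : NonUnitalNormedRing (EnvelopingCStarAlgebra B))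
  __ := (inferInstance : StarRing (EnvelopingCStarAlgebra B))
  __ := (inferInstance : CompleteSpace (EnvelopingCStarAlgebra B))
  __ := (inferInstance : NormedSpace ℂ (EnvelopingCStarAlgebra B))
  norm_mul_self_le := ind (isClosed_le (by fun_prop) (by fun_prop)) fun a => by
    rw [← ofPre_star, ← ofPre_mul, norm_ofPre, norm_ofPre, PreEnvelope.norm_star_mul_self]
  smul_assoc := smul_mul_env
  smul_comm c x y := (mul_smul_env c x y).symm
  star_smul := star_smul_env

/-- The canonical order of a `C*`-algebra, whose positive elements are the `star x * x`. -/
noncomputable instance [StarModule ℂ B] [IsScalarTower ℂ B B] [SMulCommClass ℂ B B] :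
    PartialOrder (EnvelopingCStarAlgebra B) := CStarAlgebra.spectralOrder _

instance [StarModule ℂ B] [IsScalarTower ℂ B B] [SMulCommClass ℂ B B] :
    StarOrderedRing (EnvelopingCStarAlgebra B) := CStarAlgebra.spectralOrderedRing _

end EnvelopingCStarAlgebra

end Enveloping

/-! ### The higher rank Cuntz-Krieger algebra -/

section Main

variable {r : ℕ} {A D : Type*} [Finite A] {M : Fin r → Matrix A A ℤ} {δ : D → A} {h1 : CondH1 M}

/-- Each `C*`-seminorm on `𝒜₀` is at most `1` on the generators, which are partial isometries. -/
theorem CStarSeminorm.gen_le_one (p : CStarSeminorm (Alg0 M δ h1)) (u v : DWord M δ)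
    (h : u.t = v.t) : p.toSeminorm (Alg0.gen h1 u v h) ≤ 1 := by
  have key : ∀ w : DWord M δ, p.toSeminorm (Alg0.gen h1 w w rfl) ≤ 1 := by
    intro w
    have := p.star_mul_self' (Alg0.gen h1 w w rfl)
    rw [Alg0.star_gen, Alg0.gen_mul_gen] at this
    nlinarith [apply_nonneg p.toSeminorm (Alg0.gen h1 w w rfl)]
  have := p.star_mul_self' (Alg0.gen h1 u v h)
  rw [Alg0.star_gen, Alg0.gen_mul_gen] at this
  nlinarith [apply_nonneg p.toSeminorm (Alg0.gen h1 u v h), key v]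

instance : BddCStarSeminorms (Alg0 M δ h1) where
  bdd := by
    rintro ⟨x⟩
    suffices h : ∃ C : ℝ, ∀ p : CStarSeminorm (Alg0 M δ h1), p.toSeminorm (Quot.mk _ x) ≤ C by
      obtain ⟨C, hC⟩ := h
      exact ⟨C, by rintro _ ⟨p, rfl⟩; exact hC p⟩
    induction x with
    | gen u v h => exact ⟨1, fun p => p.gen_le_one u v h⟩
    | zero => exact ⟨0, fun p => (map_zero p.toSeminorm).le⟩
    | add x y ihx ihy =>
      obtain ⟨C, hC⟩ := ihx
      obtain ⟨C', hC'⟩ := ihy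
      exact ⟨C + C', fun p => (map_add_le_add p.toSeminorm _ _).trans (add_le_add (hC p) (hC' p))⟩
    | smul c x ih =>
      obtain ⟨C, hC⟩ := ih
      exact ⟨‖c‖ * C, fun p => (map_smul_eq_mul p.toSeminorm _ _).le.trans
        (mul_le_mul_of_nonneg_left (hC p) (norm_nonneg c))⟩
    | mul x y ihx ihy =>
      obtain ⟨C, hC⟩ := ihx
      obtain ⟨C', hC'⟩ := ihy
      exact ⟨C * C', fun p => (p.mul_le' _ _).trans
        (mul_le_mul (hC p) (hC' p) (apply_nonneg _ _) ((apply_nonneg _ _).trans (hC p)))⟩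

/-- The universal `C*`-algebra `𝒜` generated by partial isometries `s_{u,v}` subject to
`s_{u,v}* = s_{v,u}`, `s_{u,v} s_{v,w} = s_{u,w}`, `s_{u,v} = ∑ s_{uw,vw}` and
`s_{u,u} s_{v,v} = 0` for distinct decorated words `u, v` of shape `0`: the enveloping
`C*`-algebra of the `*`-algebra `𝒜₀`. -/
abbrev HigherRankCK (M : Fin r → Matrix A A ℤ) (δ : D → A) (h1 : CondH1 M) : Type _ :=
  EnvelopingCStarAlgebra (Alg0 M δ h1)

end Main

/-! ### Purely infinite `C*`-algebras -/

section PurelyInfinite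

variable {B : Type*} [NonUnitalCStarAlgebra B]

/-- The hereditary `C*`-subalgebra of `B` generated by a positive element `h`, i.e. the closure
of `h B h`. -/
def hereditaryGenerated (h : B) : Set B := closure (Set.range fun a => h * a * h)

/-- A projection `p` is infinite if it is Murray-von Neumann equivalent to a proper subprojection
of itself. -/
def IsInfiniteProjection [PartialOrder B] (p : B) : Prop :=
  IsStarProjection p ∧ ∃ v : B, star v * v = p ∧ v * star v < p

variable (B) in
/-- `B` is purely infinite: for each nonzero positive `h`, the hereditary `C*`-subalgebra
generated by `h` contains an infinite projection. -/
def IsPurelyInfinite [PartialOrder B] [StarOrderedRing B] : Prop :=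
  ∀ h : B, 0 ≤ h → h ≠ 0 → ∃ p ∈ hereditaryGenerated h, IsInfiniteProjection p

end PurelyInfinite

section Words

variable {r : ℕ} {A D : Type*} {M : Fin r → Matrix A A ℤ} {δ : D → A}

namespace Word

variable {m n : Fin r → ℕ}

/-- The letters of a word, as a total function (constant beyond the shape in each direction). -/
def fn (w : Word M m) (i : Fin r → ℕ) : A := w.toFun ⟨i ⊓ m, Set.mem_Iic.2 inf_le_right⟩

theorem fn_of_le (w : Word M m) {i : Fin r → ℕ} (hi : i ≤ m) : w.fn i = w.toFun ⟨i, hi⟩ := by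
  unfold fn
  congr 2
  exact inf_eq_left.2 hi

theorem ext_fn {w w' : Word M m} (h : ∀ i ≤ m, w.fn i = w'.fn i) : w = w' := by
  ext ⟨i, hi⟩
  have := h i hi
  rwa [fn_of_le _ hi, fn_of_le _ hi] at this

theorem o_eq_fn (w : Word M m) : w.o = w.fn 0 := (w.fn_of_le (fun _ => Nat.zero_le _)).symm

theorem t_eq_fn (w : Word M m) : w.t = w.fn m := (w.fn_of_le le_rfl).symm

theorem sub_fn (w : Word M m) {k l : Fin r → ℕ} (h : k + l ≤ m) {i : Fin r → ℕ} (hi : i ≤ l) :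
    (w.sub k l h).fn i = w.fn (k + i) := by
  rw [fn_of_le _ hi, fn_of_le _ ((add_le_add_right hi k).trans h)]
  rfl

theorem mul_fn_left (h1 : CondH1 M) (u : Word M m) (v : Word M n) (h : u.t = v.o)
    {i : Fin r → ℕ} (hi : i ≤ m) : (u.mul h1 v h).fn i = u.fn i := by
  conv_rhs => rw [← mul_sub_left h1 u v h]
  rw [sub_fn _ _ hi, zero_add]

theorem mul_fn_right (h1 : CondH1 M) (u : Word M m) (v : Word M n) (h : u.t = v.o)
    {i : Fin r → ℕ} (hi : i ≤ n) : (u.mul h1 v h).fn (m + i) = v.fn i := by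
  conv_rhs => rw [← mul_sub_right h1 u v h]
  rw [sub_fn _ _ hi]

theorem eq_mul (h1 : CondH1 M) (u : Word M m) (v : Word M n) (h : u.t = v.o) (w : Word M (m + n))
    (hu : ∀ i ≤ m, w.fn i = u.fn i) (hv : ∀ i ≤ n, w.fn (m + i) = v.fn i) : w = u.mul h1 v h := by
  refine (h1 m n u v h).unique ⟨ext_fn fun i hi => ?_, ext_fn fun i hi => ?_⟩
    ⟨mul_sub_left h1 u v h, mul_sub_right h1 u v h⟩
  · rw [sub_fn _ _ hi, zero_add, hu i hi]
  · rw [sub_fn _ _ hi, hv i hi]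

/-- The word of shape `0` at a vertex. -/
def point (M : Fin r → Matrix A A ℤ) (a : A) : Word M 0 where
  toFun _ := a
  adm j l l' h := by
    have h2 : (l' : Fin r → ℕ) j = 0 := Nat.le_zero.1 (l'.2 j)
    rw [h] at h2
    simp at h2

/-- The word of shape `e_j` given by an edge of colour `j`. -/
def edge {j : Fin r} {a b : A} (h : M j b a = 1) : Word M (Pi.single j 1) where
  toFun i := if (i : Fin r → ℕ) j = 0 then a else b
  adm k l l' hl := by
    have h2 := l'.2 k
    have h3 := l'.2 j
    simp only [hl, Pi.add_apply, Pi.single_eq_same] at h2 h3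
    have hk : k = j := by
      by_contra hk
      rw [Pi.single_eq_of_ne hk] at h2
      omega
    subst hk
    rw [hl, Pi.add_apply, Pi.single_eq_same]
    rw [if_neg (by omega), if_pos (by omega)]
    exact h

theorem edge_o {j : Fin r} {a b : A} (h : M j b a = 1) : (edge h).o = a := by
  simp [o, edge]

theorem edge_t {j : Fin r} {a b : A} (h : M j b a = 1) : (edge h).t = b := by
  simp [t, edge]

theorem exists_path (h1 : CondH1 M) (h2 : CondH2 M) (a b : A) :
    ∃ (m : Fin r → ℕ) (w : Word M m), w.o = a ∧ w.t = b := by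
  induction h2 a b with
  | refl => exact ⟨0, point M a, rfl, rfl⟩
  | tail _ h ih =>
    obtain ⟨j, hj⟩ := h
    obtain ⟨m, w, rfl, ht⟩ := ih
    exact ⟨_, w.mul h1 (edge hj) (ht.trans (edge_o hj).symm), mul_o .., (mul_t ..).trans (edge_t hj)⟩

theorem not_isPeriodic_iff {w : Word M m} {p : Fin r → ℤ} : ¬ w.IsPeriodic p ↔
    ∃ i ≤ m, ∃ j ≤ m, (∀ k, (j k : ℤ) = p k + i k) ∧ w.fn i ≠ w.fn j := by
  unfold IsPeriodic
  push Not
  constructor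
  · rintro ⟨⟨i, hi⟩, ⟨j, hj⟩, h, hne⟩
    refine ⟨i, hi, j, hj, h, ?_⟩
    rwa [fn_of_le _ hi, fn_of_le _ hj]
  · rintro ⟨i, hi, j, hj, h, hne⟩
    refine ⟨⟨i, hi⟩, ⟨j, hj⟩, h, ?_⟩
    rwa [fn_of_le _ hi, fn_of_le _ hj] at hne

theorem not_isPeriodic_mul_left (h1 : CondH1 M) (u : Word M m) (v : Word M n) (h : u.t = v.o)
    {p : Fin r → ℤ} (hp : ¬ u.IsPeriodic p) : ¬ (u.mul h1 v h).IsPeriodic p := by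
  rw [not_isPeriodic_iff] at hp ⊢
  obtain ⟨i, hi, j, hj, hij, hne⟩ := hp
  refine ⟨i, hi.trans le_self_add, j, hj.trans le_self_add, hij, ?_⟩
  rwa [mul_fn_left _ _ _ _ hi, mul_fn_left _ _ _ _ hj]

theorem not_isPeriodic_mul_right (h1 : CondH1 M) (u : Word M m) (v : Word M n) (h : u.t = v.o)
    {p : Fin r → ℤ} (hp : ¬ v.IsPeriodic p) : ¬ (u.mul h1 v h).IsPeriodic p := by
  rw [not_isPeriodic_iff] at hp ⊢
  obtain ⟨i, hi, j, hj, hij, hne⟩ := hp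
  refine ⟨m + i, add_le_add_right hi m, m + j, add_le_add_right hj m, fun k => ?_, ?_⟩
  · simp only [Pi.add_apply, Nat.cast_add, hij k]
    ring
  · rwa [mul_fn_right _ _ _ _ hi, mul_fn_right _ _ _ _ hj]

theorem exists_aperiodic (h1 : CondH1 M) (h2 : CondH2 M) (h3 : CondH3 M) (a : A)
    (s : Finset (Fin r → ℤ)) (hs : (0 : Fin r → ℤ) ∉ s) :
    ∃ (m : Fin r → ℕ) (w : Word M m), w.o = a ∧ ∀ p ∈ s, ¬ w.IsPeriodic p := by
  classical
  induction s using Finset.induction_on with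
  | empty => exact ⟨0, point M a, rfl, by simp⟩
  | insert p s _ ih =>
    simp only [Finset.mem_insert, not_or] at hs
    obtain ⟨m, w, rfl, hw⟩ := ih hs.2
    obtain ⟨n, v, hv⟩ := h3 p (Ne.symm hs.1)
    obtain ⟨k, g, hgo, hgt⟩ := exists_path h1 h2 w.t v.o
    have hwg : (w.mul h1 g hgo.symm).t = v.o := (mul_t ..).trans hgt
    refine ⟨_, (w.mul h1 g hgo.symm).mul h1 v hwg, (mul_o ..).trans (mul_o ..), ?_⟩
    intro q hq
    rcases Finset.mem_insert.1 hq with rfl | hq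
    · exact not_isPeriodic_mul_right _ _ _ _ hv
    · exact not_isPeriodic_mul_left _ _ _ _ (not_isPeriodic_mul_left _ _ _ _ (hw q hq))

/-- At each vertex there are two different words of the same shape, one of them closed. -/
theorem exists_branching_loop (hr : 1 ≤ r) (h0 : CondH0 M) (h1 : CondH1 M) (h2 : CondH2 M)
    (h3 : CondH3 M) (a : A) :
    ∃ (m n : Fin r → ℕ) (g : Word M m) (g' : Word M n), m = n ∧ g.o = a ∧ g.t = a ∧ g'.o = a ∧
      ∃ i ≤ m, g.fn i ≠ g'.fn i := by
  obtain ⟨j⟩ : Nonempty (Fin r) := ⟨⟨0, hr⟩⟩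
  obtain ⟨c, b, hbc⟩ : ∃ b c, M j c b = 1 := by
    by_contra! h
    refine (h0 j).1 (Matrix.ext fun b a => ?_)
    exact ((h0 j).2 a b).resolve_right (h a b)
  obtain ⟨k, u, rfl, hut⟩ := exists_path h1 h2 a c
  obtain ⟨k', v, hvo, hvt⟩ := exists_path h1 h2 b u.o
  have hg1 : u.t = (edge hbc).o := hut.trans (edge_o hbc).symm
  have hg2 : (u.mul h1 (edge hbc) hg1).t = v.o := (mul_t ..).trans ((edge_t hbc).trans hvo.symm)
  obtain ⟨m, g, hm, hgo, hgt⟩ : ∃ (m : Fin r → ℕ) (g : Word M m), m ≠ 0 ∧ g.o = u.o ∧ g.t = u.o := by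
    refine ⟨_, (u.mul h1 (edge hbc) hg1).mul h1 v hg2, ?_, (mul_o ..).trans (mul_o ..),
      (mul_t ..).trans hvt⟩
    intro h
    have := congrFun h j
    simp at this
  obtain ⟨n, w, hw⟩ := h3 (fun k => (m k : ℤ)) fun h => hm (funext fun k => by simpa using congrFun h k)
  obtain ⟨k₁, x, hxo, hxt⟩ := exists_path h1 h2 u.o w.o
  obtain ⟨k₂, y, hyo, hyt⟩ := exists_path h1 h2 w.t u.o
  have hwy := hyo.symm
  have hxw : x.t = (w.mul h1 y hwy).o := hxt.trans (mul_o ..).symm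
  obtain ⟨N, z, hzo, hzt, hz⟩ : ∃ (N : Fin r → ℕ) (z : Word M N), z.o = u.o ∧ z.t = u.o ∧
      ¬ z.IsPeriodic (fun k => (m k : ℤ)) :=
    ⟨_, x.mul h1 (w.mul h1 y hwy) hxw, (mul_o ..).trans hxo,
      (mul_t ..).trans ((mul_t ..).trans hyt),
      not_isPeriodic_mul_right _ _ _ _ (not_isPeriodic_mul_left _ _ _ _ hw)⟩
  refine ⟨m + N, N + m, g.mul h1 z (hgt.trans hzo.symm), z.mul h1 g (hzt.trans hgo.symm),
    add_comm _ _, (mul_o ..).trans hgo, (mul_t ..).trans hzt, (mul_o ..).trans hzo, ?_⟩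
  by_contra! h
  obtain ⟨i, hi, l, hl, hil, hne⟩ := not_isPeriodic_iff.1 hz
  obtain rfl : l = m + i := funext fun k => by
    have := hil k
    simp only [Pi.add_apply]
    omega
  apply hne
  have := h (m + i) (add_le_add_right hi m)
  rwa [mul_fn_right _ _ _ _ hi, mul_fn_left _ _ _ _ hl] at this

end Word

namespace DWord

/-- The letters of a decorated word, as a total function. -/
def fn (u : DWord M δ) (i : Fin r → ℕ) : A := u.word.fn i

theorem ext_fn {u v : DWord M δ} (hs : u.shape = v.shape) (hd : u.deco = v.deco)
    (h : ∀ i ≤ u.shape, u.fn i = v.fn i) : u = v := by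
  obtain ⟨m, d, w, hw⟩ := u
  obtain ⟨n, e, x, hx⟩ := v
  obtain rfl : m = n := hs
  obtain rfl : d = e := hd
  obtain rfl : w = x := Word.ext_fn h
  rfl

theorem t_eq_fn (u : DWord M δ) : u.t = u.fn u.shape := u.word.t_eq_fn

/-- The initial segment of shape `k` of a decorated word. -/
def res (u : DWord M δ) (k : Fin r → ℕ) (hk : k ≤ u.shape) : DWord M δ where
  shape := k
  deco := u.deco
  word := u.word.sub 0 k (by rwa [zero_add])
  o_eq := by
    rw [← u.o_eq, Word.o_eq_fn, Word.o_eq_fn, Word.sub_fn _ _ (i := 0) (fun _ => Nat.zero_le _), zero_add]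

theorem res_fn (u : DWord M δ) {k : Fin r → ℕ} (hk : k ≤ u.shape) {i : Fin r → ℕ} (hi : i ≤ k) :
    (u.res k hk).fn i = u.fn i := by
  unfold fn res
  rw [Word.sub_fn _ _ hi, zero_add]

theorem mul_fn_left (h1 : CondH1 M) (u : DWord M δ) {n : Fin r → ℕ} (w : Word M n)
    (h : u.t = w.o) {i : Fin r → ℕ} (hi : i ≤ u.shape) : (u.mul h1 w h).fn i = u.fn i :=
  Word.mul_fn_left h1 u.word w h hi

theorem mul_fn_right (h1 : CondH1 M) (u : DWord M δ) {n : Fin r → ℕ} (w : Word M n)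
    (h : u.t = w.o) {i : Fin r → ℕ} (hi : i ≤ n) : (u.mul h1 w h).fn (u.shape + i) = w.fn i :=
  Word.mul_fn_right h1 u.word w h hi

/-- `u'` and `v'` arise from `u` and `v` by appending the same word. -/
structure SameTail (u v u' v' : DWord M δ) (n : Fin r → ℕ) : Prop where
  shape_left : u'.shape = u.shape + n
  shape_right : v'.shape = v.shape + n
  deco_left : u'.deco = u.deco
  deco_right : v'.deco = v.deco
  fn_left : ∀ i ≤ u.shape, u'.fn i = u.fn i
  fn_right : ∀ i ≤ v.shape, v'.fn i = v.fn i
  tail : ∀ i ≤ n, u'.fn (u.shape + i) = v'.fn (v.shape + i)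

theorem sameTail_mul (h1 : CondH1 M) (u v : DWord M δ) {n : Fin r → ℕ} (w : Word M n)
    (hu : u.t = w.o) (hv : v.t = w.o) : SameTail u v (u.mul h1 w hu) (v.mul h1 w hv) n where
  shape_left := rfl
  shape_right := rfl
  deco_left := rfl
  deco_right := rfl
  fn_left _ hi := u.mul_fn_left h1 w hu hi
  fn_right _ hi := v.mul_fn_left h1 w hv hi
  tail i hi := by rw [u.mul_fn_right h1 w hu hi, v.mul_fn_right h1 w hv hi]

theorem SameTail.t_eq {u v u' v' : DWord M δ} {n : Fin r → ℕ} (h : SameTail u v u' v' n) :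
    u.t = v.t := by
  have := h.tail 0 (fun _ => Nat.zero_le _)
  rw [add_zero, add_zero, h.fn_left _ le_rfl, h.fn_right _ le_rfl] at this
  rw [t_eq_fn, t_eq_fn, this]

theorem SameTail.exists_mul (h1 : CondH1 M) {u v u' v' : DWord M δ} {n : Fin r → ℕ}
    (h : SameTail u v u' v' n) : ∃ (w : Word M n) (hu : u.t = w.o) (hv : v.t = w.o),
      u' = u.mul h1 w hu ∧ v' = v.mul h1 w hv := by
  have hvt := h.t_eq
  obtain ⟨hs, hs', hd, hd', hf, hf', ht⟩ := h
  obtain ⟨m, d, x, hx⟩ := u'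
  obtain ⟨m', d', x', hx'⟩ := v'
  obtain rfl : m = _ := hs
  obtain rfl : m' = _ := hs'
  obtain rfl : d = _ := hd
  obtain rfl : d' = _ := hd'
  have hu : u.t = (x.sub u.shape n le_rfl).o := by
    rw [t_eq_fn, ← hf _ le_rfl, Word.o_eq_fn, Word.sub_fn _ _ (i := 0) (fun _ => Nat.zero_le _), add_zero]
    rfl
  refine ⟨x.sub u.shape n le_rfl, hu, hvt.symm.trans hu, ?_, ?_⟩
  · unfold mul
    congr
    exact Word.eq_mul _ _ _ _ _ hf fun i hi => (Word.sub_fn _ _ hi).symm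
  · unfold mul
    congr
    refine Word.eq_mul _ _ _ _ _ hf' fun i hi => ?_
    rw [Word.sub_fn _ _ hi]
    exact (ht i hi).symm

/-- Every vertex is the terminus of a decorated word. -/
theorem exists_t_eq [Nonempty D] (h1 : CondH1 M) (h2 : CondH2 M) (a : A) :
    ∃ u : DWord M δ, u.t = a := by
  obtain ⟨d⟩ := ‹Nonempty D›
  obtain ⟨m, w, ho, ht⟩ := Word.exists_path h1 h2 (δ d) a
  exact ⟨⟨m, d, w, ho⟩, ht⟩

end DWord

end Words

section CStarLemmas

variable {B : Type*} [NonUnitalCStarAlgebra B]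

theorem IsStarProjection.norm_le_one {p : B} (hp : IsStarProjection p) : ‖p‖ ≤ 1 := by
  have h := CStarRing.norm_star_mul_self (x := p)
  rw [hp.isSelfAdjoint.star_eq, hp.isIdempotentElem.eq] at h
  by_contra! h'
  nlinarith

/-- Projections whose sum is a projection are mutually orthogonal. -/
theorem IsStarProjection.mul_eq_zero_of_sum [PartialOrder B] [StarOrderedRing B] {ι : Type*}
    (s : Finset ι) (p : ι → B) (hp : ∀ i ∈ s, IsStarProjection (p i))
    (hs : IsStarProjection (∑ i ∈ s, p i)) {i j : ι} (hi : i ∈ s) (hj : j ∈ s) (hij : i ≠ j) :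
    p i * p j = 0 := by
  classical
  set P := ∑ i ∈ s, p i with hP
  have hstar : ∀ k ∈ s, star (p k) = p k := fun k hk => (hp k hk).isSelfAdjoint.star_eq
  have hmul : ∀ k ∈ s, p k * p k = p k := fun k hk => (hp k hk).isIdempotentElem.eq
  have hPs : star P = P := hs.isSelfAdjoint.star_eq
  have hPP : P * P = P := hs.isIdempotentElem.eq
  have h1 : star (p j - P * p j) * (p j - P * p j) = p j - p j * P * p j := by
    simp only [star_sub, star_mul, hstar j hj, hPs, sub_mul, mul_sub, hmul j hj]
    have : p j * P * (P * p j) = p j * P * p j := by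
      rw [mul_assoc, ← mul_assoc P P, hPP, mul_assoc]
    rw [this, mul_assoc]
    abel
  have h2 : p j * P * p j = p j + ∑ k ∈ s.erase j, star (p k * p j) * (p k * p j) := by
    rw [hP, ← Finset.add_sum_erase s p hj, mul_add, add_mul, hmul j hj, hmul j hj, Finset.mul_sum,
      Finset.sum_mul]
    congr 1
    refine Finset.sum_congr rfl fun k hk => ?_
    have hk := Finset.mem_of_mem_erase hk
    rw [star_mul, hstar j hj, hstar k hk]
    simp only [mul_assoc]
    rw [← mul_assoc (p k) (p k), hmul k hk]
  have h3 : (∑ k ∈ s.erase j, star (p k * p j) * (p k * p j)) ≤ 0 := by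
    have := star_mul_self_nonneg (p j - P * p j)
    rw [h1, h2, sub_add_cancel_left] at this
    exact neg_nonneg.1 this
  have h4 : star (p i * p j) * (p i * p j) ≤ 0 :=
    (Finset.single_le_sum (f := fun k => star (p k * p j) * (p k * p j))
      (fun k _ => star_mul_self_nonneg _) (Finset.mem_erase.2 ⟨hij, hi⟩)).trans h3
  exact CStarRing.star_mul_self_eq_zero_iff _ |>.1 (le_antisymm h4 (star_mul_self_nonneg _))

end CStarLemmas

section Family

variable {r : ℕ} {A D : Type*}

/-- A family of elements of a `C*`-algebra satisfying the relations of the generators `s_{u,v}`,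
extended by `0` to pairs with `t(u) ≠ t(v)`. -/
structure CKFamily (M : Fin r → Matrix A A ℤ) (δ : D → A) (h1 : CondH1 M) (B : Type*)
    [NonUnitalCStarAlgebra B] where
  S : DWord M δ → DWord M δ → B
  S_of_ne : ∀ {u v}, u.t ≠ v.t → S u v = 0
  star_S : ∀ u v, star (S u v) = S v u
  S_mul_S : ∀ {u v w}, v.t = w.t → S u v * S v w = S u w
  S_eq_sum : ∀ (j : Fin r) (a : A) (u v : DWord M δ) (hu : u.t = a) (hv : v.t = a)
    [Fintype {w : Word M (Pi.single j 1) // w.o = a}],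
    S u v = ∑ w : {w : Word M (Pi.single j 1) // w.o = a},
      S (u.mul h1 w.1 (hu.trans w.2.symm)) (v.mul h1 w.1 (hv.trans w.2.symm))
  orth : ∀ {u v}, u.shape = 0 → v.shape = 0 → u ≠ v → S u u * S v v = 0

namespace CKFamily

variable {M : Fin r → Matrix A A ℤ} {δ : D → A} {h1 : CondH1 M} {B : Type*}
  [NonUnitalCStarAlgebra B] (F : CKFamily M δ h1 B)

theorem isStarProjection (u : DWord M δ) : IsStarProjection (F.S u u) :=
  ⟨F.S_mul_S rfl, F.star_S u u⟩

theorem S_mul_proj (u v : DWord M δ) : F.S u v * F.S v v = F.S u v := F.S_mul_S rfl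

theorem proj_mul_S (u v : DWord M δ) : F.S u u * F.S u v = F.S u v := by
  rw [← F.star_S v u, ← F.star_S u u, ← star_mul, S_mul_proj]

/-- The span of the `s_{u,v}` with `v` of shape `m`. -/
def rightSpan (m : Fin r → ℕ) : Submodule ℂ B :=
  Submodule.span ℂ (Set.range fun x : DWord M δ × {v : DWord M δ // v.shape = m} => F.S x.1 x.2)

theorem S_mem_rightSpan (u v : DWord M δ) : F.S u v ∈ F.rightSpan v.shape :=
  Submodule.subset_span ⟨(u, ⟨v, rfl⟩), rfl⟩

variable [Finite A]

theorem rightSpan_le_add_single (m : Fin r → ℕ) (j : Fin r) :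
    F.rightSpan m ≤ F.rightSpan (m + Pi.single j 1) := by
  refine Submodule.span_le.2 ?_
  rintro _ ⟨⟨u, v, rfl⟩, rfl⟩
  by_cases h : u.t = v.t
  · let _ : Fintype {w : Word M (Pi.single j 1) // w.o = v.t} := Fintype.ofFinite _
    change F.S u v ∈ _
    rw [F.S_eq_sum j v.t u v h rfl]
    exact Submodule.sum_mem _ fun w _ => F.S_mem_rightSpan _ (v.mul h1 w.1 w.2.symm)
  · change F.S u v ∈ _
    rw [F.S_of_ne h]
    exact Submodule.zero_mem _

theorem rightSpan_mono : Monotone F.rightSpan := by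
  intro m n hmn
  obtain ⟨k, rfl⟩ := exists_add_of_le hmn
  clear hmn
  induction hN : ∑ i, k i generalizing k with
  | zero =>
    obtain rfl : k = 0 := funext fun i => by simpa using (Finset.sum_eq_zero_iff.1 hN) i
    rw [add_zero]
  | succ N ih =>
    obtain ⟨j, hj⟩ : ∃ j, k j ≠ 0 := by
      by_contra! h0
      simp [h0] at hN
    obtain ⟨k', rfl⟩ : ∃ k', k = k' + Pi.single j 1 :=
      ⟨k - Pi.single j 1, (tsub_add_cancel_of_le fun i => by
        rcases eq_or_ne i j with rfl | hi
        · simp; omega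
        · simp [hi]).symm⟩
    rw [← add_assoc]
    refine (ih k' ?_).trans (F.rightSpan_le_add_single _ j)
    simp [Finset.sum_add_distrib] at hN
    omega

/-- The span of the `s_{u,v}`. -/
def fullSpan : Submodule ℂ B := ⨆ m, F.rightSpan m

theorem mem_fullSpan {x : B} : x ∈ F.fullSpan ↔ ∃ m, x ∈ F.rightSpan m :=
  Submodule.mem_iSup_of_directed _ F.rightSpan_mono.directed_le

theorem S_mem_fullSpan (u v : DWord M δ) : F.S u v ∈ F.fullSpan :=
  F.mem_fullSpan.2 ⟨_, F.S_mem_rightSpan u v⟩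

theorem fullSpan_eq_span : F.fullSpan =
    Submodule.span ℂ (Set.range fun x : DWord M δ × DWord M δ => F.S x.1 x.2) := by
  refine le_antisymm (iSup_le fun m => Submodule.span_mono ?_) (Submodule.span_le.2 ?_)
  · rintro _ ⟨⟨u, v, _⟩, rfl⟩
    exact ⟨(u, v), rfl⟩
  · rintro _ ⟨⟨u, v⟩, rfl⟩
    exact F.S_mem_fullSpan u v

theorem star_mem_fullSpan {x : B} (hx : x ∈ F.fullSpan) : star x ∈ F.fullSpan := by
  rw [fullSpan_eq_span] at hx
  induction hx using Submodule.span_induction with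
  | mem x hx =>
    obtain ⟨⟨u, v⟩, rfl⟩ := hx
    change star (F.S u v) ∈ _
    rw [F.star_S]
    exact F.S_mem_fullSpan v u
  | zero => rw [star_zero]; exact Submodule.zero_mem _
  | add x y _ _ hx hy => rw [star_add]; exact Submodule.add_mem _ hx hy
  | smul c x _ hx => rw [star_smul]; exact Submodule.smul_mem _ _ hx

variable [PartialOrder B] [StarOrderedRing B]

theorem proj_mul_proj_of_edge_ne (j : Fin r) (u : DWord M δ) {w w' : Word M (Pi.single j 1)}
    (h : u.t = w.o) (h' : u.t = w'.o) (hne : w ≠ w') :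
    F.S (u.mul h1 w h) (u.mul h1 w h) * F.S (u.mul h1 w' h') (u.mul h1 w' h') = 0 := by
  let _ : Fintype {w : Word M (Pi.single j 1) // w.o = u.t} := Fintype.ofFinite _
  exact IsStarProjection.mul_eq_zero_of_sum Finset.univ
    (fun w : {w : Word M (Pi.single j 1) // w.o = u.t} =>
      F.S (u.mul h1 w.1 w.2.symm) (u.mul h1 w.1 w.2.symm))
    (fun _ _ => F.isStarProjection _)
    (by rw [← F.S_eq_sum j u.t u u rfl rfl]; exact F.isStarProjection u)
    (i := ⟨w, h.symm⟩) (j := ⟨w', h'.symm⟩) (Finset.mem_univ _) (Finset.mem_univ _)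
    fun h => hne (congrArg Subtype.val h)

theorem S_mul_proj_mul_edge (j : Fin r) (u v : DWord M δ) (w : Word M (Pi.single j 1))
    (hu : u.t = w.o) (hv : v.t = w.o) :
    F.S u v * F.S (v.mul h1 w hv) (v.mul h1 w hv) = F.S (u.mul h1 w hu) (v.mul h1 w hv) := by
  let _ : Fintype {x : Word M (Pi.single j 1) // x.o = w.o} := Fintype.ofFinite _
  rw [F.S_eq_sum j w.o u v hu hv, Finset.sum_mul, Finset.sum_eq_single ⟨w, rfl⟩]
  · exact F.S_mul_proj _ _
  · intro x _ hx
    rw [← F.S_mul_proj _ (v.mul h1 x.1 _), mul_assoc, F.proj_mul_proj_of_edge_ne, mul_zero]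
    exact fun h => hx (Subtype.ext h)
  · exact fun h => (h (Finset.mem_univ _)).elim

theorem S_mul_proj_of_sameTail {n : Fin r → ℕ} {u v u' v' : DWord M δ}
    (h : DWord.SameTail u v u' v' n) : F.S u v * F.S v' v' = F.S u' v' := by
  induction hN : ∑ k, n k generalizing n u v u' v' with
  | zero =>
    obtain rfl : n = 0 := funext fun k => by simpa using (Finset.sum_eq_zero_iff.1 hN) k
    obtain rfl : u' = u := DWord.ext_fn (by simp [h.shape_left]) h.deco_left
      fun i hi => h.fn_left i (hi.trans (by simp [h.shape_left]))
    obtain rfl : v' = v := DWord.ext_fn (by simp [h.shape_right]) h.deco_right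
      fun i hi => h.fn_right i (hi.trans (by simp [h.shape_right]))
    exact F.S_mul_proj _ _
  | succ N ih =>
    obtain ⟨j, hj⟩ : ∃ j, n j ≠ 0 := by
      by_contra! h0
      simp [h0] at hN
    obtain ⟨n', rfl⟩ : ∃ n', n = Pi.single j 1 + n' :=
      ⟨n - Pi.single j 1, (add_tsub_cancel_of_le fun k => by
        rcases eq_or_ne k j with rfl | hk
        · simp; omega
        · simp [hk]).symm⟩
    have hN' : ∑ k, n' k = N := by
      simp [Finset.sum_add_distrib] at hN
      omega
    have hu : u.shape + Pi.single j 1 ≤ u'.shape := by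
      rw [h.shape_left, ← add_assoc]; exact le_self_add
    have hv : v.shape + Pi.single j 1 ≤ v'.shape := by
      rw [h.shape_right, ← add_assoc]; exact le_self_add
    have hle : (Pi.single j 1 : Fin r → ℕ) ≤ Pi.single j 1 + n' := le_self_add
    have t1 : DWord.SameTail u v (u'.res _ hu) (v'.res _ hv) (Pi.single j 1) :=
      { shape_left := rfl
        shape_right := rfl
        deco_left := h.deco_left
        deco_right := h.deco_right
        fn_left := fun i hi => by rw [u'.res_fn hu (hi.trans le_self_add), h.fn_left i hi]
        fn_right := fun i hi => by rw [v'.res_fn hv (hi.trans le_self_add), h.fn_right i hi]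
        tail := fun i hi => by
          rw [u'.res_fn hu (add_le_add_right hi _), v'.res_fn hv (add_le_add_right hi _),
            h.tail i (hi.trans hle)] }
    have t2 : DWord.SameTail (u'.res _ hu) (v'.res _ hv) u' v' n' :=
      { shape_left := by rw [h.shape_left, ← add_assoc]; rfl
        shape_right := by rw [h.shape_right, ← add_assoc]; rfl
        deco_left := rfl
        deco_right := rfl
        fn_left := fun i hi => (u'.res_fn hu hi).symm
        fn_right := fun i hi => (v'.res_fn hv hi).symm
        tail := fun i hi => by
          change u'.fn (u.shape + Pi.single j 1 + i) = v'.fn (v.shape + Pi.single j 1 + i)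
          rw [add_assoc, add_assoc, h.tail _ (add_le_add_right hi _)] }
    have t3 : DWord.SameTail (v'.res _ hv) (v'.res _ hv) v' v' n' :=
      ⟨t2.2, t2.2, rfl, rfl, t2.6, t2.6, fun _ _ => rfl⟩
    have hstep : F.S u v * F.S (v'.res _ hv) (v'.res _ hv) = F.S (u'.res _ hu) (v'.res _ hv) := by
      obtain ⟨w, hw, hw', e, e'⟩ := t1.exists_mul h1
      rw [e, e']
      exact F.S_mul_proj_mul_edge j u v w hw hw'
    rw [← ih t3 hN', ← mul_assoc, hstep, ih t2 hN']

theorem S_mul_proj_mul (u v : DWord M δ) {n : Fin r → ℕ} (w : Word M n) (hu : u.t = w.o)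
    (hv : v.t = w.o) :
    F.S u v * F.S (v.mul h1 w hv) (v.mul h1 w hv) = F.S (u.mul h1 w hu) (v.mul h1 w hv) :=
  F.S_mul_proj_of_sameTail (DWord.sameTail_mul h1 u v w hu hv)

theorem proj_res_mul_proj (u : DWord M δ) (k : Fin r → ℕ) (hk : k ≤ u.shape) :
    F.S (u.res k hk) (u.res k hk) * F.S u u = F.S u u := by
  have hs : u.shape = k + (u.shape - k) := (add_tsub_cancel_of_le hk).symm
  exact F.S_mul_proj_of_sameTail (n := u.shape - k)
    ⟨hs, hs, rfl, rfl, fun i hi => (u.res_fn hk hi).symm, fun i hi => (u.res_fn hk hi).symm,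
      fun _ _ => rfl⟩

theorem proj_mul_proj_res (u : DWord M δ) (k : Fin r → ℕ) (hk : k ≤ u.shape) :
    F.S u u * F.S (u.res k hk) (u.res k hk) = F.S u u := by
  simpa only [star_mul, F.star_S] using congrArg star (F.proj_res_mul_proj u k hk)

theorem proj_mul_proj_of_res {u v : DWord M δ} {k : Fin r → ℕ} (hu : k ≤ u.shape)
    (hv : k ≤ v.shape)
    (h : F.S (u.res k hu) (u.res k hu) * F.S (v.res k hv) (v.res k hv) = 0) :
    F.S u u * F.S v v = 0 := by
  rw [← F.proj_mul_proj_res u k hu, ← F.proj_res_mul_proj v k hv, mul_assoc,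
    ← mul_assoc (F.S (u.res k hu) (u.res k hu)), h, zero_mul, mul_zero]

theorem proj_mul_proj_of_ne {u v : DWord M δ} (hs : u.shape = v.shape) (hne : u ≠ v) :
    F.S u u * F.S v v = 0 := by
  induction hN : ∑ k, u.shape k generalizing u v with
  | zero =>
    have h0 : u.shape = 0 := funext fun k => by simpa using (Finset.sum_eq_zero_iff.1 hN) k
    exact F.orth h0 (hs ▸ h0) hne
  | succ N ih =>
    obtain ⟨j, hj⟩ : ∃ j, u.shape j ≠ 0 := by
      by_contra! h0
      simp [h0] at hN
    have hle : Pi.single j 1 ≤ u.shape := fun k => by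
      rcases eq_or_ne k j with rfl | hk
      · simp; omega
      · simp [hk]
    obtain ⟨k, hk⟩ : ∃ k : Fin r → ℕ, u.shape = k + Pi.single j 1 := ⟨_, (tsub_add_cancel_of_le hle).symm⟩
    have hku : k ≤ u.shape := hk ▸ le_self_add
    have hkv : k ≤ v.shape := hs ▸ hku
    have hN' : ∑ i, k i = N := by
      simp [hk, Finset.sum_add_distrib] at hN
      omega
    by_cases h : u.res k hku = v.res k hkv
    · have tail : ∀ (x : DWord M δ) (hkx : k ≤ x.shape), x.shape = k + Pi.single j 1 →
          ∃ (w : Word M (Pi.single j 1)) (hw : (x.res k hkx).t = w.o), x = (x.res k hkx).mul h1 w hw := by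
        intro x hkx hx
        have t : DWord.SameTail (x.res k hkx) (x.res k hkx) x x (Pi.single j 1) :=
          ⟨hx, hx, rfl, rfl, fun i hi => (x.res_fn hkx hi).symm,
            fun i hi => (x.res_fn hkx hi).symm, fun _ _ => rfl⟩
        obtain ⟨w, hw, -, e, -⟩ := t.exists_mul h1
        exact ⟨w, hw, e⟩
      obtain ⟨w, hw, e⟩ := tail u hku hk
      obtain ⟨w', hw', e'⟩ := tail v hkv (hs ▸ hk)
      generalize u.res k hku = x at h hw e
      generalize v.res k hkv = y at h hw' e'
      subst h e e'
      refine F.proj_mul_proj_of_edge_ne j x hw hw' ?_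
      rintro rfl
      exact hne rfl
    · exact F.proj_mul_proj_of_res hku hkv (ih rfl h hN')

theorem proj_mul_proj_of_fn_ne {u v : DWord M δ} {i : Fin r → ℕ} (hu : i ≤ u.shape)
    (hv : i ≤ v.shape) (hne : u.fn i ≠ v.fn i) : F.S u u * F.S v v = 0 := by
  refine F.proj_mul_proj_of_res hu hv (F.proj_mul_proj_of_ne rfl fun h => hne ?_)
  rw [← u.res_fn hu le_rfl, h, v.res_fn hv le_rfl]

theorem S_mul_S_of_ne (u : DWord M δ) {v w : DWord M δ} (x : DWord M δ) (hs : v.shape = w.shape)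
    (hne : v ≠ w) : F.S u v * F.S w x = 0 := by
  rw [← F.S_mul_proj u v, ← F.proj_mul_S w x, mul_assoc, ← mul_assoc (F.S v v),
    F.proj_mul_proj_of_ne hs hne, zero_mul, mul_zero]

/-- If one of the projections of the family vanishes, so does the whole family. -/
theorem eq_zero_of_proj_eq_zero (h2 : CondH2 M) {e : DWord M δ} (he : F.S e e = 0)
    (u v : DWord M δ) : F.S u v = 0 := by
  obtain ⟨m, w, ho, ht⟩ := Word.exists_path h1 h2 e.t v.t
  have h : F.S (e.mul h1 w ho.symm) (e.mul h1 w ho.symm) = 0 := by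
    rw [← F.S_mul_proj_mul e e w ho.symm ho.symm, he, zero_mul]
  have hv : v.t = (e.mul h1 w ho.symm).t := ((e.mul_t h1 w ho.symm).trans ht).symm
  rw [← F.S_mul_proj u v, ← F.S_mul_S (u := v) (w := v) hv.symm,
    ← F.S_mul_proj v (e.mul h1 w ho.symm), h, mul_zero, zero_mul, mul_zero]

theorem S_mul_S_mem_fullSpan (u v w x : DWord M δ) : F.S u v * F.S w x ∈ F.fullSpan := by
  have h1 := F.rightSpan_mono (le_sup_left : v.shape ≤ v.shape ⊔ w.shape) (F.S_mem_rightSpan u v)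
  have h2 := F.rightSpan_mono (le_sup_right : w.shape ≤ v.shape ⊔ w.shape) (F.S_mem_rightSpan x w)
  rw [← F.star_S x w]
  generalize v.shape ⊔ w.shape = m at h1 h2
  generalize F.S u v = y at h1
  generalize F.S x w = z at h2
  induction h1 using Submodule.span_induction with
  | mem y hy =>
    obtain ⟨⟨a, b, hb⟩, rfl⟩ := hy
    induction h2 using Submodule.span_induction with
    | mem z hz =>
      obtain ⟨⟨c, d, hd⟩, rfl⟩ := hz
      change F.S a b * star (F.S c d) ∈ _
      rw [F.star_S]
      by_cases hbd : b = d
      · subst hbd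
        by_cases hc : b.t = c.t
        · rw [F.S_mul_S hc]
          exact F.S_mem_fullSpan a c
        · rw [F.S_of_ne hc, mul_zero]
          exact Submodule.zero_mem _
      · rw [F.S_mul_S_of_ne a c (hb.trans hd.symm) hbd]
        exact Submodule.zero_mem _
    | zero => rw [star_zero, mul_zero]; exact Submodule.zero_mem _
    | add x y _ _ hx hy => rw [star_add, mul_add]; exact Submodule.add_mem _ hx hy
    | smul c x _ hx => rw [star_smul, mul_smul_comm]; exact Submodule.smul_mem _ _ hx
  | zero => rw [zero_mul]; exact Submodule.zero_mem _
  | add x y _ _ hx hy => rw [add_mul]; exact Submodule.add_mem _ hx hy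
  | smul c x _ hx => rw [smul_mul_assoc]; exact Submodule.smul_mem _ _ hx

theorem mul_mem_fullSpan {x y : B} (hx : x ∈ F.fullSpan) (hy : y ∈ F.fullSpan) :
    x * y ∈ F.fullSpan := by
  rw [fullSpan_eq_span] at hx hy
  induction hx using Submodule.span_induction with
  | mem x hx =>
    obtain ⟨⟨u, v⟩, rfl⟩ := hx
    induction hy using Submodule.span_induction with
    | mem y hy =>
      obtain ⟨⟨w, x⟩, rfl⟩ := hy
      exact F.S_mul_S_mem_fullSpan u v w x
    | zero => rw [mul_zero]; exact Submodule.zero_mem _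
    | add x y _ _ hx hy => rw [mul_add]; exact Submodule.add_mem _ hx hy
    | smul c x _ hx => rw [mul_smul_comm]; exact Submodule.smul_mem _ _ hx
  | zero => rw [zero_mul]; exact Submodule.zero_mem _
  | add x y _ _ hx hy => rw [add_mul]; exact Submodule.add_mem _ hx hy
  | smul c x _ hx => rw [smul_mul_assoc]; exact Submodule.smul_mem _ _ hx

end CKFamily

end Family

section CornerLemmas

variable {B : Type*} [NonUnitalCStarAlgebra B]

theorem exists_corner_inverse {q b : B} (hq : IsStarProjection q) (hb : star b = b)
    (hqb : q * b = b) {c : ℂ} (hc : ‖b - c • q‖ < ‖c‖) :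
    ∃ x : B, star x = x ∧ q * x = x ∧ b * x = q ∧ x * b = q := by
  have hc0 : c ≠ 0 := norm_pos_iff.1 ((norm_nonneg _).trans_lt hc)
  have hqq : q * q = q := hq.isIdempotentElem.eq
  have hqs : star q = q := hq.isSelfAdjoint.star_eq
  set k : B := q - c⁻¹ • b with hk
  have hknorm : ‖k‖ < 1 := by
    have : k = -(c⁻¹ • (b - c • q)) := by
      rw [smul_sub, smul_smul, inv_mul_cancel₀ hc0, one_smul, neg_sub]
    rw [this, norm_neg, norm_smul, norm_inv, inv_mul_lt_iff₀ (norm_pos_iff.2 hc0), mul_one]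
    exact hc
  have hqk : q * k = k := by rw [hk, mul_sub, hqq, mul_smul_comm, hqb]
  have hu : IsUnit (1 - ContinuousLinearMap.mul ℂ B k) :=
    isUnit_one_sub_of_norm_lt_one ((ContinuousLinearMap.opNorm_mul_apply_le ℂ B k).trans_lt hknorm)
  obtain ⟨u, hu⟩ := hu
  obtain ⟨y, hy⟩ : ∃ y : B, y - k * y = q := by
    refine ⟨(↑u⁻¹ : B →L[ℂ] B) q, ?_⟩
    have h : (1 - ContinuousLinearMap.mul ℂ B k) * (↑u⁻¹ : B →L[ℂ] B) = 1 := by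
      rw [← hu, Units.mul_inv]
    simpa using congrArg (fun f : B →L[ℂ] B => f q) h
  have hqy : q * y = y := by
    have h : y = q + k * y := by rw [← hy]; abel
    rw [h, mul_add, hqq, ← mul_assoc, hqk]
  have hby : b * y = c • q := by
    have : b = c • (q - k) := by
      rw [hk, sub_sub_cancel, smul_smul, mul_inv_cancel₀ hc0, one_smul]
    rw [this, smul_mul_assoc, sub_mul, hqy, hy]
  have hyb : star y * b = star c • q := by
    rw [← hb, ← star_mul, hby, star_smul, hqs]
  have hys : star c • y = c • star y := by
    have h1 : star y * b * y = star c • y := by rw [hyb, smul_mul_assoc, hqy]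
    have h2 : star y * b * y = c • star y := by
      rw [mul_assoc, hby, mul_smul_comm]
      nth_rw 1 [← hqs]
      rw [← star_mul, hqy]
    rw [← h1, h2]
  have hbx : b * (c⁻¹ • y) = q := by
    rw [mul_smul_comm, hby, smul_smul, inv_mul_cancel₀ hc0, one_smul]
  have hxs : star (c⁻¹ • y) = c⁻¹ • y := by
    have hc1 : star c ≠ 0 := star_ne_zero.2 hc0
    have : star y = c⁻¹ • star c • y := by rw [hys, smul_smul, inv_mul_cancel₀ hc0, one_smul]
    rw [star_smul, this, star_inv₀, smul_smul, smul_smul]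
    congr 1
    field_simp
  refine ⟨c⁻¹ • y, hxs, by rw [mul_smul_comm, hqy], hbx, ?_⟩
  rw [← hxs, ← hb, ← star_mul, hbx, hqs]

theorem IsStarProjection.mul_eq_self_of_star_mul_self {q a : B} (hq : IsStarProjection q)
    (ha : star a * a = q) : a * q = a := by
  have hqq : q * q = q := hq.isIdempotentElem.eq
  have hqs : star q = q := hq.isSelfAdjoint.star_eq
  have h0 : star (a - a * q) * (a - a * q) = 0 := by
    rw [star_sub, star_mul, hqs, sub_mul, mul_sub, mul_sub, ha, ← mul_assoc, ha, hqq,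
      mul_assoc, ha, hqq, mul_assoc q (star a), ← mul_assoc (star a) a q, ha, hqq, hqq]
    simp
  exact (sub_eq_zero.1 ((CStarRing.star_mul_self_eq_zero_iff _).1 h0)).symm

variable [PartialOrder B] [StarOrderedRing B]

theorem IsStarProjection.mul_eq_right_of_le {p q : B} (hp : IsStarProjection p)
    (hq : IsStarProjection q) (h : p ≤ q) : q * p = p := by
  have hqq : q * q = q := hq.isIdempotentElem.eq
  have hqs : star q = q := hq.isSelfAdjoint.star_eq
  have hpp : p * p = p := hp.isIdempotentElem.eq
  have hps : star p = p := hp.isSelfAdjoint.star_eq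
  have h0 : star (p - q * p) * (p - q * p) = p - p * q * p := by
    rw [star_sub, star_mul, hqs, hps, sub_mul, mul_sub, mul_sub, hpp, ← mul_assoc (p * q),
      mul_assoc p q q, hqq, mul_assoc]
    abel
  have h1 : p ≤ p * q * p := by
    have := star_left_conjugate_le_conjugate h p
    rwa [hps, hpp, hpp] at this
  have h2 := h0.trans_le (sub_nonpos.2 h1)
  exact (sub_eq_zero.1 ((CStarRing.star_mul_self_eq_zero_iff _).1
    (le_antisymm h2 (star_mul_self_nonneg _)))).symm

/-- A projection equivalent to an infinite projection is infinite. -/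
theorem IsInfiniteProjection.of_equiv {q v : B} (hq : IsInfiniteProjection q)
    (hv : star v * v = q) : IsInfiniteProjection (v * star v) := by
  obtain ⟨hq, u, hu, hlt⟩ := hq
  have hqs : star q = q := hq.isSelfAdjoint.star_eq
  have hqq : q * q = q := hq.isIdempotentElem.eq
  have hvq : v * q = v := hq.mul_eq_self_of_star_mul_self hv
  have hqv : q * star v = star v := by rw [← hqs, ← star_mul, hvq]
  have huq : u * q = u := hq.mul_eq_self_of_star_mul_self hu
  have hqu' : q * star u = star u := by rw [← hqs, ← star_mul, huq]
  have hp : IsStarProjection (u * star u) := by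
    refine ⟨?_, ?_⟩
    · change u * star u * (u * star u) = _
      rw [mul_assoc, ← mul_assoc (star u), hu, hqu']
    · change star _ = _
      rw [star_mul, star_star]
  have hqp : q * (u * star u) = u * star u := hp.mul_eq_right_of_le hq hlt.le
  have hpq : u * star u * q = u * star u := by
    have := congrArg star hqp
    rwa [star_mul, hp.isSelfAdjoint.star_eq, hqs] at this
  have hqu : q * u = u := by
    calc q * u = q * (u * (star u * u)) := by rw [hu, huq]
      _ = q * (u * star u) * u := by simp only [mul_assoc]
      _ = u := by rw [hqp, mul_assoc, hu, huq]
  refine ⟨⟨?_, ?_⟩, v * u * star v, ?_, ?_⟩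
  · change v * star v * (v * star v) = _
    rw [mul_assoc, ← mul_assoc (star v), hv, hqv]
  · change star (v * star v) = _
    rw [star_mul, star_star]
  · calc star (v * u * star v) * (v * u * star v)
        = v * star u * ((star v * v) * u) * star v := by
          rw [star_mul, star_mul, star_star]; simp only [mul_assoc]
      _ = v * (star u * u) * star v := by rw [hv, hqu, mul_assoc v]
      _ = v * star v := by rw [hu, hvq]
  · have e : v * u * star v * star (v * u * star v) = v * (u * star u) * star v := by
      calc v * u * star v * star (v * u * star v)
          = v * (u * (star v * v)) * star u * star v := by
            rw [star_mul, star_mul, star_star]; simp only [mul_assoc]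
        _ = v * (u * star u) * star v := by rw [hv, huq]; simp only [mul_assoc]
    rw [e]
    refine lt_of_le_of_ne ?_ fun h => hlt.ne ?_
    · calc v * (u * star u) * star v ≤ v * q * star v := star_right_conjugate_le_conjugate hlt.le v
        _ = v * star v := by rw [hvq]
    · calc u * star u = q * (u * star u) * q := by rw [hqp, hpq]
        _ = star v * (v * (u * star u) * star v) * v := by rw [← hv]; simp only [mul_assoc]
        _ = star v * (v * star v) * v := by rw [h]
        _ = q := by rw [← mul_assoc, hv, mul_assoc, hv, hqq]

/-- If `T* h² T` is close to a multiple of an infinite projection `q`, the hereditary subalgebra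
generated by `h` contains a projection equivalent to `q`, which is infinite. -/
theorem exists_infinite_projection_of_compression {h T q : B} (hh : 0 ≤ h)
    (hqi : IsInfiniteProjection q) (hT : T * q = T) {c : ℂ} (hc : ‖star T * (h * h) * T - c • q‖ < ‖c‖) :
    ∃ p ∈ hereditaryGenerated h, IsInfiniteProjection p := by
  have hhs : star h = h := (IsSelfAdjoint.of_nonneg hh).star_eq
  have hq := hqi.1
  have hqq : q * q = q := hq.isIdempotentElem.eq
  have hqs : star q = q := hq.isSelfAdjoint.star_eq
  have hqT : q * star T = star T := by rw [← hqs, ← star_mul, hT]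
  set y : B := h * T with hy
  set b : B := star T * (h * h) * T with hb
  have hyb : star y * y = b := by rw [hy, hb, star_mul, hhs]; simp only [mul_assoc]
  have hb0 : 0 ≤ b := hyb ▸ star_mul_self_nonneg y
  have hbs : star b = b := (IsSelfAdjoint.of_nonneg hb0).star_eq
  have hqb : q * b = b := by rw [hb, ← mul_assoc, ← mul_assoc, hqT]
  have hbq : b * q = b := by rw [hb, mul_assoc, hT]
  obtain ⟨x, hxs, hqx, hbx, hxb⟩ := exists_corner_inverse hq hbs hqb hc
  have hxq : x * q = x := by rw [← hxs, ← hqs, ← star_mul, hqx]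
  set s : B := CFC.sqrt b with hs
  have hss : s * s = b := CFC.sqrt_mul_sqrt_self b hb0
  have hs0 : 0 ≤ s := CFC.sqrt_nonneg b
  have hsstar : star s = s := (IsSelfAdjoint.of_nonneg hs0).star_eq
  have hsq : s * q = s := by
    have h0 : star (s - s * q) * (s - s * q) = 0 := by
      rw [star_sub, star_mul, hsstar, hqs, sub_mul, mul_sub, mul_sub, hss, ← mul_assoc, hss, hbq,
        mul_assoc, hss, hqb, mul_assoc q s, ← mul_assoc s s q, hss, hbq, hqb]
      simp
    exact (sub_eq_zero.1 ((CStarRing.star_mul_self_eq_zero_iff _).1 h0)).symm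
  have hqs' : q * s = s := by
    have := congrArg star hsq
    rwa [star_mul, hqs, hsstar] at this
  have hsb : s * b = b * s := by rw [← hss, mul_assoc]
  have hsx : x * s = s * x := by
    calc x * s = x * (s * b) * x := by rw [mul_assoc, mul_assoc, hbx, hsq]
      _ = x * b * s * x := by rw [hsb]; simp only [mul_assoc]
      _ = s * x := by rw [hxb, hqs']
  set d : B := s * x with hd
  have hds : star d = d := by rw [hd, star_mul, hxs, hsstar, hsx]
  have hdq : d * q = d := by rw [hd, mul_assoc, hxq]
  set v : B := y * d with hv
  have hvv : star v * v = q := by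
    calc star v * v = d * (star y * y) * d := by rw [hv, star_mul, hds]; simp only [mul_assoc]
      _ = x * s * b * (s * x) := by rw [hyb, hd, hsx]
      _ = x * (s * (s * b)) * x := by rw [hsb]; simp only [mul_assoc]
      _ = (x * b) * (b * x) := by rw [← mul_assoc s, hss]; simp only [mul_assoc]
      _ = q := by rw [hxb, hbx, hqq]
  refine ⟨v * star v, subset_closure ⟨T * d * (d * star T), ?_⟩, hqi.of_equiv hvv⟩
  change h * (T * d * (d * star T)) * h = _
  have hvs : star v = d * (star T * h) := by rw [hv, star_mul, hds, hy, star_mul, hhs]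
  rw [hvs, hv, hy]
  simp only [mul_assoc]

end CornerLemmas

section Main

open scoped ComplexConjugate ComplexOrder

variable {r : ℕ} {A D : Type*} [Finite A] {M : Fin r → Matrix A A ℤ} {δ : D → A} {h1 : CondH1 M}
  {B : Type*} [NonUnitalCStarAlgebra B] [PartialOrder B] [StarOrderedRing B]

namespace CKFamily

variable (F : CKFamily M δ h1 B)

theorem sum_smul_S_nonneg {m : Fin r → ℕ} {a : A} (Z : Finset (DWord M δ))
    (hm : ∀ u ∈ Z, u.shape = m) (ha : ∀ u ∈ Z, u.t = a) (X : Matrix Z Z ℂ) (hX : X.PosSemidef) :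
    0 ≤ ∑ u : Z, ∑ v : Z, X u v • F.S u v := by
  classical
  open scoped MatrixOrder in
  have h := StarOrderedRing.nonneg_iff.1 hX.nonneg
  clear hX
  induction h using AddSubmonoid.closure_induction with
  | mem x hx =>
    obtain ⟨Y, rfl⟩ := hx
    have key : ∑ u : Z, ∑ v : Z, (star Y * Y) u v • F.S u v =
        star (∑ u : Z, ∑ v : Z, Y u v • F.S u v) * ∑ u : Z, ∑ v : Z, Y u v • F.S u v := by
      simp only [star_sum, star_smul, F.star_S, Finset.sum_mul, Finset.mul_sum, smul_mul_smul_comm]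
      have h2 : ∀ k u k' v : Z, (star (Y k u) * Y k' v) • (F.S u k * F.S k' v) =
          if k' = k then (star (Y k u) * Y k v) • F.S u v else 0 := by
        intro k u k' v
        split_ifs with hk
        · subst hk
          rw [F.S_mul_S ((ha _ k'.2).trans (ha _ v.2).symm)]
        · rw [F.S_mul_S_of_ne _ _ ((hm _ k.2).trans (hm _ k'.2).symm)
            fun h => hk (Subtype.ext h.symm), smul_zero]
      simp only [Matrix.mul_apply, Matrix.star_apply, Finset.sum_smul]
      calc ∑ u : Z, ∑ v : Z, ∑ k : Z, (star (Y k u) * Y k v) • F.S u v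
          = ∑ v : Z, ∑ u : Z, ∑ k : Z, (star (Y k u) * Y k v) • F.S u v := Finset.sum_comm
        _ = ∑ v : Z, ∑ k : Z, ∑ u : Z, (star (Y k u) * Y k v) • F.S u v :=
            Finset.sum_congr rfl fun v _ => Finset.sum_comm
        _ = ∑ k : Z, ∑ v : Z, ∑ u : Z, (star (Y k u) * Y k v) • F.S u v := Finset.sum_comm
        _ = _ := by
          refine Finset.sum_congr rfl fun k _ => Finset.sum_congr rfl fun v _ => ?_
          rw [Finset.sum_comm]
          refine Finset.sum_congr rfl fun u _ => ?_
          simp only [h2, Finset.sum_ite_eq, Finset.mem_univ, if_true]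
    rw [key]
    exact star_mul_self_nonneg _
  | zero => simp
  | add X Y _ _ hX hY =>
    simp only [Matrix.add_apply, add_smul, Finset.sum_add_distrib]
    exact add_nonneg hX hY

omit [Finite A] [PartialOrder B] [StarOrderedRing B] in
theorem sum_sum_fiberwise [DecidableEq A] [DecidableEq (DWord M δ)] (Z : Finset (DWord M δ))
    (G : DWord M δ → DWord M δ → ℂ) :
    ∑ a ∈ Z.image DWord.t, ∑ u ∈ Z with u.t = a, ∑ v ∈ Z with v.t = a, G u v • F.S u v =
      ∑ u ∈ Z, ∑ v ∈ Z, G u v • F.S u v := by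
  rw [← Finset.sum_fiberwise_of_maps_to (fun u hu => Finset.mem_image_of_mem DWord.t hu)]
  refine Finset.sum_congr rfl fun a _ => Finset.sum_congr rfl fun u hu => ?_
  refine Finset.sum_filter_of_ne fun v _ hv => ?_
  by_contra h
  rw [F.S_of_ne fun h' => h (h'.symm.trans (Finset.mem_filter.1 hu).2), smul_zero] at hv
  exact hv rfl

theorem isStarProjection_sum {m : Fin r → ℕ} (Z : Finset (DWord M δ))
    (hm : ∀ u ∈ Z, u.shape = m) : IsStarProjection (∑ u ∈ Z, F.S u u) := by
  classical
  refine ⟨?_, ?_⟩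
  · change (∑ u ∈ Z, F.S u u) * (∑ u ∈ Z, F.S u u) = _
    rw [Finset.sum_mul]
    refine Finset.sum_congr rfl fun u hu => ?_
    rw [Finset.mul_sum, Finset.sum_eq_single_of_mem u hu, F.S_mul_proj]
    exact fun v hv hvu => F.proj_mul_proj_of_ne ((hm u hu).trans (hm v hv).symm) hvu.symm
  · change star _ = _
    simp only [star_sum, F.star_S]

/-- A positive combination of the `s_{u,v}` with `u, v` of shape `m` whose matrices of
coefficients have numerical range at most `d` has norm at most `d`. -/
theorem norm_le_of_quadratic_le {m : Fin r → ℕ} (Z : Finset (DWord M δ))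
    (hm : ∀ u ∈ Z, u.shape = m) (C : DWord M δ → DWord M δ → ℂ)
    (hf : 0 ≤ ∑ u ∈ Z, ∑ v ∈ Z, C u v • F.S u v) {d : ℝ} (hd : 0 ≤ d)
    (hC : ∀ (Y : Finset (DWord M δ)) (a : A) (ξ : DWord M δ → ℂ), Y ⊆ Z → (∀ u ∈ Y, u.t = a) →
      (∑ u ∈ Y, ∑ v ∈ Y, conj (ξ u) * C u v * ξ v).re ≤ d * ∑ u ∈ Y, ‖ξ u‖ ^ 2) :
    ‖∑ u ∈ Z, ∑ v ∈ Z, C u v • F.S u v‖ ≤ d := by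
  classical
  set f := ∑ u ∈ Z, ∑ v ∈ Z, C u v • F.S u v with hfdef
  set H : DWord M δ → DWord M δ → ℂ := fun u v => (C u v + conj (C v u)) / 2 with hH
  have hfs : f = ∑ u ∈ Z, ∑ v ∈ Z, conj (C v u) • F.S u v := by
    rw [← (IsSelfAdjoint.of_nonneg hf).star_eq, hfdef, Finset.sum_comm]
    simp only [star_sum, star_smul, F.star_S]
    rfl
  have hfH : f = ∑ u ∈ Z, ∑ v ∈ Z, H u v • F.S u v := by
    have h : ∑ u ∈ Z, ∑ v ∈ Z, H u v • F.S u v = (1 / 2 : ℂ) • (f + f) := by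
      nth_rw 2 [hfs]
      rw [hfdef, ← Finset.sum_add_distrib, Finset.smul_sum]
      refine Finset.sum_congr rfl fun u _ => ?_
      rw [← Finset.sum_add_distrib, Finset.smul_sum]
      refine Finset.sum_congr rfl fun v _ => ?_
      rw [← add_smul, smul_smul, hH]
      congr 1
      ring
    rw [h, ← two_smul ℂ f, smul_smul]
    norm_num
  set G : DWord M δ → DWord M δ → ℂ := fun u v => (if u = v then (d : ℂ) else 0) - H u v with hG
  have hGf : ∑ u ∈ Z, ∑ v ∈ Z, G u v • F.S u v = (d : ℂ) • ∑ u ∈ Z, F.S u u - f := by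
    rw [hfH, Finset.smul_sum, ← Finset.sum_sub_distrib]
    refine Finset.sum_congr rfl fun u hu => ?_
    simp only [hG, sub_smul, Finset.sum_sub_distrib, ite_smul, zero_smul, Finset.sum_ite_eq, hu,
      if_true]
  have hnonneg : 0 ≤ ∑ u ∈ Z, ∑ v ∈ Z, G u v • F.S u v := by
    rw [← F.sum_sum_fiberwise]
    refine Finset.sum_nonneg fun a _ => ?_
    set Y := Z.filter (fun u => u.t = a) with hY
    have hYZ : Y ⊆ Z := Finset.filter_subset _ _
    have hYa : ∀ u ∈ Y, u.t = a := fun u hu => (Finset.mem_filter.1 hu).2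
    have hpsd : (Matrix.of fun u v : Y => G u v).PosSemidef := by
      refine Matrix.PosSemidef.of_dotProduct_mulVec_nonneg ?_ fun x => ?_
      · ext u v
        simp only [Matrix.conjTranspose_apply, Matrix.of_apply, hG, hH, star_sub, RCLike.star_def,
          map_div₀, map_add, Complex.conj_conj]
        congr 1
        · by_cases h : u = v
          · simp [h]
          · have h1 : (v : DWord M δ) ≠ u := fun h' => h (Subtype.ext h'.symm)
            simp [h1, h1.symm]
        · rw [add_comm, map_ofNat]
      · set ξ : DWord M δ → ℂ := Function.extend Subtype.val x 0
        have hξ : ∀ u : Y, x u = ξ u := fun u => (Subtype.val_injective.extend_apply x 0 u).symm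
        have e : star x ⬝ᵥ (Matrix.of fun u v : Y => G u v).mulVec x =
            ((d * ∑ u ∈ Y, ‖ξ u‖ ^ 2 - (∑ u ∈ Y, ∑ v ∈ Y, conj (ξ u) * C u v * ξ v).re : ℝ) : ℂ) := by
          have e1 : star x ⬝ᵥ (Matrix.of fun u v : Y => G u v).mulVec x =
              ∑ u ∈ Y, ∑ v ∈ Y, conj (ξ u) * G u v * ξ v := by
            rw [← Finset.sum_coe_sort Y]
            simp only [dotProduct, Matrix.mulVec, Finset.mul_sum, Matrix.of_apply, Pi.star_apply,
              RCLike.star_def, hξ, mul_assoc]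
            refine Finset.sum_congr rfl fun u _ => ?_
            exact Finset.sum_coe_sort Y fun v => conj (ξ u) * (G u v * ξ v)
          have e2 : ∑ u ∈ Y, ∑ v ∈ Y, conj (ξ u) * H u v * ξ v =
              ((∑ u ∈ Y, ∑ v ∈ Y, conj (ξ u) * C u v * ξ v).re : ℂ) := by
            set q := ∑ u ∈ Y, ∑ v ∈ Y, conj (ξ u) * C u v * ξ v with hq
            have hqc : conj q = ∑ u ∈ Y, ∑ v ∈ Y, conj (ξ u) * conj (C v u) * ξ v := by
              rw [hq, Finset.sum_comm, map_sum]
              refine Finset.sum_congr rfl fun u _ => ?_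
              rw [map_sum]
              refine Finset.sum_congr rfl fun v _ => ?_
              rw [map_mul, map_mul, Complex.conj_conj]
              ring
            rw [Complex.re_eq_add_conj, hqc, hq, ← Finset.sum_add_distrib, Finset.sum_div]
            refine Finset.sum_congr rfl fun u _ => ?_
            rw [← Finset.sum_add_distrib, Finset.sum_div]
            refine Finset.sum_congr rfl fun v _ => ?_
            rw [hH]
            ring
          rw [e1, Complex.ofReal_sub, ← e2]
          push_cast
          rw [Finset.mul_sum, ← Finset.sum_sub_distrib]
          refine Finset.sum_congr rfl fun u hu => ?_
          simp only [hG, mul_sub, sub_mul, Finset.sum_sub_distrib, mul_ite, ite_mul, mul_zero,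
            zero_mul, Finset.sum_ite_eq, hu, if_true]
          rw [← Complex.conj_mul']
          ring
        rw [e, Complex.zero_le_real, sub_nonneg]
        exact hC Y a ξ hYZ hYa
    have := F.sum_smul_S_nonneg Y (fun u hu => hm u (hYZ hu)) hYa _ hpsd
    simp only [Matrix.of_apply] at this
    refine this.trans_eq ?_
    rw [← Finset.sum_coe_sort Y]
    refine Finset.sum_congr rfl fun u _ => ?_
    exact Finset.sum_coe_sort Y fun v => G u v • F.S u v
  rw [hGf, sub_nonneg] at hnonneg
  refine (CStarAlgebra.norm_le_norm_of_nonneg_of_le hf hnonneg).trans ?_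
  rw [norm_smul, Complex.norm_of_nonneg hd]
  exact mul_le_of_le_one_right hd (F.isStarProjection_sum Z hm).norm_le_one

omit [Finite A] [PartialOrder B] [StarOrderedRing B] in
theorem S_mul_S_of_proj {x y : DWord M δ} (h : F.S x x * F.S y y = 0) (u v : DWord M δ) :
    F.S u x * F.S y v = 0 := by
  rw [← F.S_mul_proj u x, ← F.proj_mul_S y v, mul_assoc, ← mul_assoc (F.S x x), h, zero_mul,
    mul_zero]

theorem proj_mul_left_ext (u : DWord M δ) {n : Fin r → ℕ} (w : Word M n) (hu : u.t = w.o) :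
    F.S u u * F.S (u.mul h1 w hu) (u.mul h1 w hu) = F.S (u.mul h1 w hu) (u.mul h1 w hu) :=
  F.S_mul_proj_mul u u w hu hu

theorem proj_mul_right_ext (u : DWord M δ) {n : Fin r → ℕ} (w : Word M n) (hu : u.t = w.o) :
    F.S (u.mul h1 w hu) (u.mul h1 w hu) * F.S u u = F.S (u.mul h1 w hu) (u.mul h1 w hu) := by
  simpa only [star_mul, F.star_S] using congrArg star (F.proj_mul_left_ext u w hu)

theorem proj_ext_mul_proj_ext {u v : DWord M δ} (h : F.S u u * F.S v v = 0) {n : Fin r → ℕ}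
    (w : Word M n) (hu : u.t = w.o) (hv : v.t = w.o) :
    F.S (u.mul h1 w hu) (u.mul h1 w hu) * F.S (v.mul h1 w hv) (v.mul h1 w hv) = 0 := by
  rw [← F.proj_mul_right_ext u w hu, ← F.proj_mul_left_ext v w hv, mul_assoc,
    ← mul_assoc (F.S u u), h, zero_mul, mul_zero]

theorem isInfiniteProjection (hr : 1 ≤ r) (h0 : CondH0 M) (h2 : CondH2 M) (h3 : CondH3 M)
    (hne : ∀ u, F.S u u ≠ 0) (e : DWord M δ) : IsInfiniteProjection (F.S e e) := by
  obtain ⟨m, n, g, g', rfl, hgo, hgt, hgo', i, hi, hfn⟩ :=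
    Word.exists_branching_loop hr h0 h1 h2 h3 e.t
  have ht : (e.mul h1 g hgo.symm).t = e.t := (e.mul_t h1 g hgo.symm).trans hgt
  refine ⟨F.isStarProjection e, F.S (e.mul h1 g hgo.symm) e, ?_, ?_⟩
  · rw [F.star_S, F.S_mul_S ht]
  · rw [F.star_S, F.S_mul_S ht.symm]
    refine lt_of_le_of_ne ?_ fun h => ?_
    · exact (F.isStarProjection _).le_of_mul_eq_left (F.isStarProjection e)
        (F.proj_mul_right_ext e g hgo.symm)
    · refine hne (e.mul h1 g' hgo'.symm) ?_
      rw [← F.proj_mul_left_ext e g' hgo'.symm, ← h]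
      refine F.proj_mul_proj_of_fn_ne (i := e.shape + i) (add_le_add_right hi _)
        (add_le_add_right hi _) ?_
      rwa [e.mul_fn_right h1 g _ hi, e.mul_fn_right h1 g' _ hi]

/-- Extending by an aperiodic word separates decorated words of different shapes. -/
theorem proj_ext_mul_proj_ext_of_aperiodic {u v : DWord M δ} {n : Fin r → ℕ} (w : Word M n)
    (hu : u.t = w.o) (hv : v.t = w.o)
    (hw : ¬ w.IsPeriodic fun k => (v.shape k : ℤ) - u.shape k) :
    F.S (u.mul h1 w hu) (u.mul h1 w hu) * F.S (v.mul h1 w hv) (v.mul h1 w hv) = 0 := by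
  obtain ⟨i, hi, j, hj, hij, hne⟩ := Word.not_isPeriodic_iff.1 hw
  have hs : u.shape + j = v.shape + i := funext fun k => by
    have := hij k
    simp only [Pi.add_apply]
    omega
  refine F.proj_mul_proj_of_fn_ne (i := u.shape + j) (add_le_add_right hj _)
    (hs ▸ add_le_add_right hi _) ?_
  rw [u.mul_fn_right h1 w hu hj, hs, v.mul_fn_right h1 w hv hi]
  exact hne.symm

end CKFamily
end Main

section MainAbstract

open scoped ComplexConjugate ComplexOrder

variable {r : ℕ} {A D : Type*} [Finite A] {M : Fin r → Matrix A A ℤ} {δ : D → A} {h1 : CondH1 M}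
  {B : Type*} [NonUnitalCStarAlgebra B]

namespace CKFamily

variable (F : CKFamily M δ h1 B)

omit [Finite A] in
theorem exists_finsupp_of_mem_rightSpan {m : Fin r → ℕ} {x : B} (hx : x ∈ F.rightSpan m) :
    ∃ l : DWord M δ × DWord M δ →₀ ℂ, (∀ i ∈ l.support, i.2.shape = m) ∧
      x = ∑ i ∈ l.support, l i • F.S i.1 i.2 := by
  have hle : F.rightSpan m ≤ Submodule.span ℂ ((fun i : DWord M δ × DWord M δ => F.S i.1 i.2) ''
      {i | i.2.shape = m}) := by
    refine Submodule.span_mono ?_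
    rintro _ ⟨⟨u, v, hv⟩, rfl⟩
    exact ⟨(u, v), hv, rfl⟩
  obtain ⟨l, hl, rfl⟩ := (Finsupp.mem_span_image_iff_linearCombination ℂ).1 (hle hx)
  exact ⟨l, fun i hi => hl hi, Finsupp.linearCombination_apply ℂ l⟩

variable [PartialOrder B] [StarOrderedRing B]

/-- Compressing a combination of generators by suitable words leaves only the terms `s_{u,v}` with
`u` and `v` of the same shape. -/
theorem exists_compression [Nonempty D] (h2 : CondH2 M) (h3 : CondH3 M)
    {m : Fin r → ℕ} (l : DWord M δ × DWord M δ →₀ ℂ) (hl : ∀ i ∈ l.support, i.2.shape = m)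
    {a : A} (Y : Finset (DWord M δ)) (hm : ∀ u ∈ Y, u.shape = m) (ha : ∀ u ∈ Y, u.t = a)
    (ξ : DWord M δ → ℂ) :
    ∃ (e : DWord M δ) (T : B), T * F.S e e = T ∧ ‖T‖ ^ 2 ≤ ∑ u ∈ Y, ‖ξ u‖ ^ 2 ∧
      star T * (∑ i ∈ l.support, l i • F.S i.1 i.2) * T =
        (∑ u ∈ Y, ∑ v ∈ Y, conj (ξ u) * l (u, v) * ξ v) • F.S e e := by
  classical
  obtain ⟨n, w, hwo, hw⟩ := Word.exists_aperiodic h1 h2 h3 a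
    ((l.support.image fun i => fun k => (i.1.shape k : ℤ) - m k).erase 0) (by simp)
  obtain ⟨e, he⟩ := DWord.exists_t_eq (D := D) (δ := δ) h1 h2 w.t
  set E : DWord M δ → DWord M δ := fun u => if h : u.t = w.o then u.mul h1 w h else u
  have hE : ∀ u (h : u.t = w.o), E u = u.mul h1 w h := fun u h => dif_pos h
  have hEt : ∀ u, u.t = w.o → (E u).t = e.t := fun u h => by rw [hE u h, he, DWord.mul_t]
  have hYo : ∀ u ∈ Y, u.t = w.o := fun u hu => (ha u hu).trans hwo.symm
  have hEE : ∀ u ∈ Y, ∀ v, v.t = w.o → (v.shape ≠ m → ∃ i ∈ l.support, i.1 = v) →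
      F.S e (E u) * F.S (E v) e = if u = v then F.S e e else 0 := by
    intro u hu v hv hv'
    split_ifs with h
    · subst h
      exact F.S_mul_S (hEt u (hYo u hu))
    · refine F.S_mul_S_of_proj ?_ _ _
      rw [hE u (hYo u hu), hE v hv]
      by_cases hs : v.shape = m
      · exact F.proj_ext_mul_proj_ext
          (F.proj_mul_proj_of_ne ((hm u hu).trans hs.symm) h) w _ _
      · obtain ⟨i, hi, rfl⟩ := hv' hs
        refine F.proj_ext_mul_proj_ext_of_aperiodic w _ _ (hw _ ?_)
        rw [hm u hu]
        refine Finset.mem_erase.2 ⟨fun h0 => hs (funext fun k => ?_),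
          Finset.mem_image_of_mem (fun i : DWord M δ × DWord M δ => fun k =>
            (i.1.shape k : ℤ) - m k) hi⟩
        have := congrFun h0 k
        simp only [Pi.zero_apply] at this
        omega
  have hmid : ∀ u ∈ Y, ∀ i ∈ l.support, ∀ v ∈ Y,
      F.S e (E u) * F.S i.1 i.2 * F.S (E v) e = if i = (u, v) then F.S e e else 0 := by
    intro u hu i hi v hv
    obtain ⟨x, y⟩ := i
    have hy : y.shape = m := hl _ hi
    by_cases hyv : y = v
    · subst hyv
      by_cases hx : x.t = y.t
      · have hxo : x.t = w.o := hx.trans (hYo y hv)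
        have : F.S x y * F.S (E y) e = F.S (E x) e := by
          rw [← F.proj_mul_S (E y) e, ← mul_assoc, hE y (hYo y hv),
            F.S_mul_proj_mul x y w hxo (hYo y hv), hE x hxo, F.S_mul_S]
          rw [DWord.mul_t, he]
        rw [mul_assoc, this, hEE u hu x hxo fun _ => ⟨_, hi, rfl⟩]
        simp only [Prod.mk.injEq, and_true, eq_comm]
      · rw [F.S_of_ne hx, mul_zero, zero_mul, if_neg]
        rintro ⟨⟩
        exact hx ((ha _ hu).trans (ha _ hv).symm)
    · rw [mul_assoc, if_neg fun h => hyv (congrArg Prod.snd h)]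
      have : F.S y y * F.S (E v) (E v) = 0 := by
        rw [hE v (hYo v hv), ← F.proj_mul_left_ext v w (hYo v hv), ← mul_assoc,
          F.proj_mul_proj_of_ne (hy.trans (hm v hv).symm) hyv, zero_mul]
      rw [F.S_mul_S_of_proj this, mul_zero]
  refine ⟨e, ∑ u ∈ Y, ξ u • F.S (E u) e, ?_, ?_, ?_⟩
  · rw [Finset.sum_mul]
    exact Finset.sum_congr rfl fun u _ => by rw [smul_mul_assoc, F.S_mul_proj]
  · have hT : star (∑ u ∈ Y, ξ u • F.S (E u) e) * ∑ u ∈ Y, ξ u • F.S (E u) e =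
        ((∑ u ∈ Y, ‖ξ u‖ ^ 2 : ℝ) : ℂ) • F.S e e := by
      simp only [star_sum, star_smul, F.star_S]
      rw [Finset.sum_mul, Complex.ofReal_sum, Finset.sum_smul]
      refine Finset.sum_congr rfl fun u hu => ?_
      rw [Finset.mul_sum, Finset.sum_eq_single_of_mem u hu]
      · rw [smul_mul_smul_comm, hEE u hu u (hYo u hu) fun h => (h (hm u hu)).elim, if_pos rfl,
          RCLike.star_def, Complex.conj_mul', Complex.ofReal_pow]
      · intro v hv hvu
        rw [smul_mul_smul_comm, hEE u hu v (hYo v hv) fun h => (h (hm v hv)).elim,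
          if_neg (Ne.symm hvu), smul_zero]
    have h0 : (0 : ℝ) ≤ ∑ u ∈ Y, ‖ξ u‖ ^ 2 := Finset.sum_nonneg fun _ _ => sq_nonneg _
    rw [sq, ← CStarRing.norm_star_mul_self, hT, norm_smul, Complex.norm_of_nonneg h0]
    exact mul_le_of_le_one_right h0 (F.isStarProjection e).norm_le_one
  · simp only [star_sum, star_smul, F.star_S, RCLike.star_def]
    rw [Finset.sum_mul, Finset.sum_mul, Finset.sum_smul]
    refine Finset.sum_congr rfl fun u hu => ?_
    rw [Finset.mul_sum, Finset.sum_smul]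
    refine Finset.sum_congr rfl fun v hv => ?_
    rw [Finset.mul_sum, Finset.sum_mul]
    have h : ∀ i ∈ l.support, conj (ξ u) • F.S e (E u) * l i • F.S i.1 i.2 * ξ v • F.S (E v) e =
        if i = (u, v) then (conj (ξ u) * l (u, v) * ξ v) • F.S e e else 0 := by
      intro i hi
      rw [smul_mul_smul_comm, smul_mul_smul_comm, hmid u hu i hi v hv]
      split_ifs with hiu
      · rw [hiu]
      · rw [smul_zero]
    rw [Finset.sum_congr rfl h, Finset.sum_ite_eq']
    split_ifs with hs
    · rfl
    · rw [Finsupp.notMem_support_iff.1 hs, mul_zero, zero_mul, zero_smul]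

/-- A `C*`-algebra generated by a family with a faithful positive map onto the diagonal part is
purely infinite. -/
theorem isPurelyInfinite [Nonempty D] (hr : 1 ≤ r) (h0 : CondH0 M) (h2 : CondH2 M) (h3 : CondH3 M)
    (hdense : Dense (F.fullSpan : Set B)) (Φ : B →L[ℂ] B) (hΦ : ∀ h, 0 ≤ h → 0 ≤ Φ h)
    (hΦ' : ∀ h, 0 ≤ h → Φ h = 0 → h = 0)
    (hΦS : ∀ u v, u.shape = v.shape → Φ (F.S u v) = F.S u v)
    (hΦS' : ∀ u v, u.shape ≠ v.shape → Φ (F.S u v) = 0) : IsPurelyInfinite B := by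
  classical
  intro h hh hne
  have hhs : star h = h := (IsSelfAdjoint.of_nonneg hh).star_eq
  have hH : star h * h = h * h := by rw [hhs]
  have hnz : ∀ u, F.S u u ≠ 0 := by
    intro u hu
    have hbot : F.fullSpan = ⊥ := by
      rw [F.fullSpan_eq_span, Submodule.span_eq_bot]
      rintro _ ⟨⟨x, y⟩, rfl⟩
      exact F.eq_zero_of_proj_eq_zero h2 hu x y
    have := hdense h
    rw [hbot, Submodule.bot_coe, closure_singleton] at this
    exact hne this
  have hc : 0 < ‖Φ (star h * h)‖ := by
    refine norm_pos_iff.2 fun h' => hne ?_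
    exact (CStarRing.star_mul_self_eq_zero_iff _).1 (hΦ' _ (star_mul_self_nonneg h) h')
  set c := ‖Φ (star h * h)‖ with hcdef
  obtain ⟨y, hy, hy1, hy2⟩ : ∃ y ∈ F.fullSpan, ‖star y * y - star h * h‖ < c / 8 ∧
      ‖Φ (star y * y) - Φ (star h * h)‖ < c / 8 := by
    have c1 : Continuous fun y : B => ‖star y * y - star h * h‖ := by fun_prop
    have c2 : Continuous fun y : B => ‖Φ (star y * y) - Φ (star h * h)‖ := by fun_prop
    have o := (isOpen_lt c1 (continuous_const (y := c / 8))).inter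
      (isOpen_lt c2 (continuous_const (y := c / 8)))
    obtain ⟨y, hy', hy⟩ := hdense.exists_mem_open o ⟨h, by simp [hc], by simp [hc]⟩
    exact ⟨y, hy', hy.1, hy.2⟩
  obtain ⟨m, hm⟩ := F.mem_fullSpan.1 (F.mul_mem_fullSpan (F.star_mem_fullSpan hy) hy)
  obtain ⟨l, hl, hx⟩ := F.exists_finsupp_of_mem_rightSpan hm
  set Z : Finset (DWord M δ) :=
    (l.support.image Prod.fst ∪ l.support.image Prod.snd).filter fun u => u.shape = m
  have hZ : ∀ u ∈ Z, u.shape = m := fun u hu => (Finset.mem_filter.1 hu).2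
  have hf : Φ (star y * y) = ∑ u ∈ Z, ∑ v ∈ Z, l (u, v) • F.S u v := by
    rw [hx, map_sum, ← Finset.sum_product']
    have e1 : ∀ i ∈ l.support, Φ (l i • F.S i.1 i.2) =
        if i.1.shape = m then l i • F.S i.1 i.2 else 0 := by
      intro i hi
      rw [map_smul]
      split_ifs with hs
      · rw [hΦS _ _ (hs.trans (hl i hi).symm)]
      · rw [hΦS' _ _ fun h' => hs (h'.trans (hl i hi)), smul_zero]
    rw [Finset.sum_congr rfl e1, ← Finset.sum_filter]
    refine Finset.sum_subset (fun i hi => ?_) fun i hi hi' => ?_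
    · obtain ⟨hi, hs⟩ := Finset.mem_filter.1 hi
      refine Finset.mem_product.2 ⟨Finset.mem_filter.2 ⟨?_, hs⟩, Finset.mem_filter.2 ⟨?_, hl i hi⟩⟩
      · exact Finset.mem_union_left _ (Finset.mem_image_of_mem _ hi)
      · exact Finset.mem_union_right _ (Finset.mem_image_of_mem _ hi)
    · have : i ∉ l.support := fun h' =>
        hi' (Finset.mem_filter.2 ⟨h', hZ _ (Finset.mem_product.1 hi).1⟩)
      change l i • F.S i.1 i.2 = 0
      rw [Finsupp.notMem_support_iff.1 this, zero_smul]
  have hlow : c / 2 < ‖Φ (star y * y)‖ := by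
    have := norm_sub_norm_le (Φ (star h * h)) (Φ (star y * y))
    rw [norm_sub_rev] at this
    linarith
  obtain ⟨Y, a, ξ, hYZ, hYa, hξ⟩ : ∃ (Y : Finset (DWord M δ)) (a : A) (ξ : DWord M δ → ℂ), Y ⊆ Z ∧
      (∀ u ∈ Y, u.t = a) ∧ c / 2 * ∑ u ∈ Y, ‖ξ u‖ ^ 2 <
        (∑ u ∈ Y, ∑ v ∈ Y, conj (ξ u) * l (u, v) * ξ v).re := by
    by_contra! hcon
    refine hlow.not_ge ?_
    have hpos := hΦ _ (star_mul_self_nonneg y)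
    rw [hf] at hpos ⊢
    exact F.norm_le_of_quadratic_le Z hZ (fun u v => l (u, v)) hpos (by positivity) hcon
  obtain ⟨e, T, hTe, hTn, hTx⟩ := F.exists_compression h2 h3 l hl Y (fun u hu => hZ u (hYZ hu)) hYa ξ
  refine exists_infinite_projection_of_compression hh (F.isInfiniteProjection hr h0 h2 h3 hnz e) hTe
    (c := ∑ u ∈ Y, ∑ v ∈ Y, conj (ξ u) * l (u, v) * ξ v) ?_
  rw [← hTx, ← hx, ← hH, ← sub_mul, ← mul_sub]
  have hN : 0 ≤ ∑ u ∈ Y, ‖ξ u‖ ^ 2 := Finset.sum_nonneg fun _ _ => sq_nonneg _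
  calc ‖star T * (star h * h - star y * y) * T‖
      ≤ ‖star T‖ * ‖star h * h - star y * y‖ * ‖T‖ :=
        (norm_mul_le _ _).trans (mul_le_mul_of_nonneg_right (norm_mul_le _ _) (norm_nonneg _))
    _ = ‖T‖ ^ 2 * ‖star y * y - star h * h‖ := by rw [norm_star, norm_sub_rev]; ring
    _ ≤ (∑ u ∈ Y, ‖ξ u‖ ^ 2) * (c / 2) :=
        mul_le_mul hTn (by linarith) (norm_nonneg _) hN
    _ = c / 2 * ∑ u ∈ Y, ‖ξ u‖ ^ 2 := mul_comm _ _
    _ < _ := hξ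
    _ ≤ _ := Complex.re_le_norm _

end CKFamily

end MainAbstract

section Averaging

open MeasureTheory

variable {B : Type*} [NonUnitalCStarAlgebra B]

/-- The average over a period of the orbits of a strongly continuous family of contractions. -/
noncomputable def orbitAverage (α : ℝ → B →L[ℂ] B) (hα : ∀ t x, ‖α t x‖ ≤ ‖x‖)
    (hc : ∀ x, Continuous fun t => α t x) : B →L[ℂ] B :=
  LinearMap.mkContinuous
    { toFun := fun x => (2 * Real.pi)⁻¹ • ∫ t in (0 : ℝ)..2 * Real.pi, α t x
      map_add' := fun x y => by
        simp only [map_add]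
        rw [intervalIntegral.integral_add ((hc x).intervalIntegrable _ _)
          ((hc y).intervalIntegrable _ _), smul_add]
      map_smul' := fun c x => by
        simp only [map_smul, RingHom.id_apply]
        rw [intervalIntegral.integral_smul, smul_comm] } 1 fun x => by
    have h := intervalIntegral.norm_integral_le_of_norm_le_const (a := 0) (b := 2 * Real.pi)
      (f := fun t => α t x) (C := ‖x‖) fun t _ => hα t x
    have hp : 0 < 2 * Real.pi := Real.two_pi_pos
    rw [sub_zero, abs_of_pos hp] at h
    change ‖(2 * Real.pi)⁻¹ • ∫ t in (0 : ℝ)..2 * Real.pi, α t x‖ ≤ _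
    rw [norm_smul, norm_inv, Real.norm_of_nonneg hp.le, inv_mul_le_iff₀ hp]
    linarith

/-- Strong continuity of a family of contractions may be tested on a dense subspace. -/
theorem continuous_orbit_of_dense {α : ℝ → B →L[ℂ] B} {V : Submodule ℂ B} (hV : Dense (V : Set B))
    (hα : ∀ t x, ‖α t x‖ ≤ ‖x‖) (hc : ∀ x ∈ V, Continuous fun t => α t x) (x : B) :
    Continuous fun t => α t x := by
  refine continuous_of_uniform_approx_of_continuous fun u hu => ?_
  obtain ⟨ε, hε, hu⟩ := Metric.mem_uniformity_dist.1 hu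
  obtain ⟨y, hy, hxy⟩ := Metric.dense_iff.1 hV x ε hε
  refine ⟨fun t => α t y, hc y hxy, fun t => hu ?_⟩
  rw [dist_eq_norm, ← map_sub]
  refine (hα t _).trans_lt ?_
  rwa [← dist_eq_norm, dist_comm]

variable {α : ℝ → B →L[ℂ] B} (hα : ∀ t x, ‖α t x‖ ≤ ‖x‖) (hc : ∀ x, Continuous fun t => α t x)

theorem orbitAverage_apply (x : B) :
    orbitAverage α hα hc x = (2 * Real.pi)⁻¹ • ∫ t in (0 : ℝ)..2 * Real.pi, α t x := rfl

theorem orbitAverage_of_eigenvector {x : B} {n : ℤ}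
    (hx : ∀ t : ℝ, α t x = Complex.exp (n * Complex.I * t) • x) :
    orbitAverage α hα hc x = if n = 0 then x else 0 := by
  rw [orbitAverage_apply]
  simp only [hx]
  rw [intervalIntegral.integral_smul_const]
  split_ifs with hn
  · subst hn
    simp only [Int.cast_zero, zero_mul, Complex.exp_zero, intervalIntegral.integral_const, sub_zero]
    rw [Complex.real_smul, mul_one, Complex.coe_smul, smul_smul,
      inv_mul_cancel₀ Real.two_pi_pos.ne', one_smul]
  · rw [integral_exp_mul_complex (by simp [hn])]
    have : (n : ℂ) * Complex.I * ((2 * Real.pi : ℝ) : ℂ) = n * (2 * Real.pi * Complex.I) := by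
      push_cast
      ring
    rw [this, Complex.exp_int_mul_two_pi_mul_I]
    simp

variable [PartialOrder B] [StarOrderedRing B]

theorem orbitAverage_nonneg (hpos : ∀ t x, 0 ≤ x → 0 ≤ α t x) {x : B} (hx : 0 ≤ x) :
    0 ≤ orbitAverage α hα hc x := by
  rw [orbitAverage_apply, intervalIntegral.integral_of_le Real.two_pi_pos.le]
  exact smul_nonneg (inv_nonneg.2 Real.two_pi_pos.le) (integral_nonneg fun t => hpos t x hx)

theorem eq_zero_of_orbitAverage_eq_zero (hpos : ∀ t x, 0 ≤ x → 0 ≤ α t x) (h0 : ∀ x, α 0 x = x)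
    {x : B} (hx : 0 ≤ x) (h : orbitAverage α hα hc x = 0) : x = 0 := by
  have hp := Real.two_pi_pos
  rw [orbitAverage_apply, smul_eq_zero, or_iff_right (inv_ne_zero hp.ne')] at h
  have hint : ∀ s ∈ Set.Ioo 0 (2 * Real.pi), ∫ t in (0 : ℝ)..s, α t x = 0 := by
    intro s hs
    rw [← intervalIntegral.integral_add_adjacent_intervals ((hc x).intervalIntegrable 0 s)
      ((hc x).intervalIntegrable s _)] at h
    refine ((add_eq_zero_iff_of_nonneg ?_ ?_).1 h).1
    · rw [intervalIntegral.integral_of_le hs.1.le]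
      exact integral_nonneg fun t => hpos t x hx
    · rw [intervalIntegral.integral_of_le hs.2.le]
      exact integral_nonneg fun t => hpos t x hx
  have hzero : ∀ s ∈ Set.Ioo 0 (2 * Real.pi), α s x = 0 := by
    intro s hs
    have hd : HasDerivAt (fun s => ∫ t in (0 : ℝ)..s, α t x) (α s x) s :=
      (hc x).integral_hasStrictDerivAt 0 s |>.hasDerivAt
    refine hd.unique ((hasDerivAt_const s (0 : B)).congr_of_eventuallyEq ?_)
    filter_upwards [isOpen_Ioo.mem_nhds hs] with t ht using hint t ht
  have hcl : (0 : ℝ) ∈ closure (Set.Ioo 0 (2 * Real.pi)) := by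
    rw [closure_Ioo hp.ne]
    exact ⟨le_rfl, hp.le⟩
  have := closure_minimal (s := Set.Ioo 0 (2 * Real.pi)) (t := {t | α t x = 0}) hzero
    (isClosed_eq (hc x) continuous_const) hcl
  rw [← h0 x]
  exact this

end Averaging

section Expectation

variable {r : ℕ} {A D : Type*} [Finite A] {M : Fin r → Matrix A A ℤ} {δ : D → A} {h1 : CondH1 M}
  {B : Type*} [NonUnitalCStarAlgebra B] [PartialOrder B] [StarOrderedRing B]

namespace CKFamily

variable (F : CKFamily M δ h1 B)

/-- Gauge actions give a faithful positive map onto the diagonal part. -/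
theorem exists_expectation (hdense : Dense (F.fullSpan : Set B)) (α : Fin r → ℝ → B →L[ℂ] B)
    (hα : ∀ j t x, ‖α j t x‖ ≤ ‖x‖) (hpos : ∀ j t x, 0 ≤ x → 0 ≤ α j t x)
    (hS : ∀ j (t : ℝ) u v, α j t (F.S u v) =
      Complex.exp (((u.shape j - v.shape j : ℤ) : ℂ) * Complex.I * t) • F.S u v) :
    ∃ Φ : B →L[ℂ] B, (∀ h, 0 ≤ h → 0 ≤ Φ h) ∧ (∀ h, 0 ≤ h → Φ h = 0 → h = 0) ∧
      (∀ u v, u.shape = v.shape → Φ (F.S u v) = F.S u v) ∧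
      (∀ u v, u.shape ≠ v.shape → Φ (F.S u v) = 0) := by
  classical
  have hc : ∀ j x, Continuous fun t => α j t x := by
    intro j x
    refine continuous_orbit_of_dense hdense (hα j) (fun x hx => ?_) x
    rw [fullSpan_eq_span] at hx
    induction hx using Submodule.span_induction with
    | mem x hx =>
      obtain ⟨⟨u, v⟩, rfl⟩ := hx
      simp only [hS]
      fun_prop
    | zero => simpa using continuous_const
    | add x y _ _ hx hy => simp only [map_add]; exact hx.add hy
    | smul c x _ hx => simp only [map_smul]; exact hx.const_smul c
  have h0 : ∀ j x, α j 0 x = x := by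
    intro j x
    refine congrFun (Continuous.ext_on hdense (α j 0).continuous continuous_id fun x hx => ?_) x
    rw [SetLike.mem_coe, fullSpan_eq_span] at hx
    induction hx using Submodule.span_induction with
    | mem x hx =>
      obtain ⟨⟨u, v⟩, rfl⟩ := hx
      simp [hS]
    | zero => simp
    | add x y _ _ hx hy => rw [map_add, hx, hy]; rfl
    | smul c x _ hx => rw [map_smul, hx]; rfl
  have key : ∀ J : Finset (Fin r), ∃ Φ : B →L[ℂ] B, (∀ h, 0 ≤ h → 0 ≤ Φ h) ∧
      (∀ h, 0 ≤ h → Φ h = 0 → h = 0) ∧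
      (∀ u v, Φ (F.S u v) = if ∀ j ∈ J, u.shape j = v.shape j then F.S u v else 0) := by
    intro J
    induction J using Finset.induction_on with
    | empty => exact ⟨ContinuousLinearMap.id ℂ B, fun _ h => h, fun _ _ h => h, by simp⟩
    | insert j J _ ih =>
      obtain ⟨Φ, hp, hf, hs⟩ := ih
      refine ⟨(orbitAverage (α j) (hα j) (hc j)).comp Φ, fun h hh =>
        orbitAverage_nonneg (hα j) (hc j) (hpos j) (hp h hh), fun h hh hz => hf h hh
        (eq_zero_of_orbitAverage_eq_zero (hα j) (hc j) (hpos j) (h0 j) (hp h hh) hz), fun u v => ?_⟩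
      rw [ContinuousLinearMap.comp_apply, hs]
      simp only [Finset.forall_mem_insert]
      by_cases h : ∀ k ∈ J, u.shape k = v.shape k
      · rw [if_pos h, orbitAverage_of_eigenvector (hα j) (hc j) fun t => hS j t u v]
        simp only [and_iff_left h, sub_eq_zero, Nat.cast_inj]
      · rw [if_neg h, map_zero, if_neg fun h' => h h'.2]
  obtain ⟨Φ, hp, hf, hs⟩ := key Finset.univ
  refine ⟨Φ, hp, hf, fun u v h => ?_, fun u v h => ?_⟩
  · rw [hs, if_pos fun j _ => congrFun h j]
  · rw [hs, if_neg fun h' => h (funext fun j => h' j (Finset.mem_univ j))]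

end CKFamily

end Expectation

section EnvelopingMap

variable {B : Type*} [NonUnitalRing B] [StarRing B] [Module ℂ B]

/-- The pullback of a `C*`-seminorm along a `*`-homomorphism. -/
noncomputable def CStarSeminorm.comp (p : CStarSeminorm B) (β : B →⋆ₙₐ[ℂ] B) : CStarSeminorm B where
  toSeminorm := p.toSeminorm.comp (β : B →ₗ[ℂ] B)
  mul_le' x y := by
    change p.toSeminorm (β (x * y)) ≤ p.toSeminorm (β x) * p.toSeminorm (β y)
    rw [map_mul]
    exact p.mul_le' _ _
  star_mul_self' x := by
    change p.toSeminorm (β (star x * x)) = p.toSeminorm (β x) ^ 2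
    rw [map_mul, map_star]
    exact p.star_mul_self' _

variable [BddCStarSeminorms B]

theorem maxCStarSeminorm_map_le (β : B →⋆ₙₐ[ℂ] B) (x : B) :
    maxCStarSeminorm (β x) ≤ maxCStarSeminorm x :=
  ciSup_le fun p => (p.comp β).le_max x

namespace EnvelopingCStarAlgebra

open UniformSpace

/-- A `*`-endomorphism as a map on the seminormed algebra. -/
def preMap (β : B →⋆ₙₐ[ℂ] B) : PreEnvelope B → PreEnvelope B := β

theorem uniformContinuous_preMap (β : B →⋆ₙₐ[ℂ] B) : UniformContinuous (preMap β) := by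
  refine LipschitzWith.uniformContinuous (K := 1) (LipschitzWith.of_dist_le_mul fun x y => ?_)
  rw [NNReal.coe_one, one_mul, dist_eq_norm, dist_eq_norm]
  have : preMap β x - preMap β y = preMap β (x - y) := (map_sub β x y).symm
  rw [this]
  exact maxCStarSeminorm_map_le β (x - y)

/-- The extension of a `*`-endomorphism to the enveloping `C*`-algebra, as a function. -/
noncomputable def mapFun (β : B →⋆ₙₐ[ℂ] B) : EnvelopingCStarAlgebra B → EnvelopingCStarAlgebra B :=
  Completion.map (preMap β)

theorem continuous_mapFun (β : B →⋆ₙₐ[ℂ] B) : Continuous (mapFun β) := Completion.continuous_map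

theorem mapFun_ofPre (β : B →⋆ₙₐ[ℂ] B) (x : PreEnvelope B) :
    mapFun β (ofPre x) = ofPre (preMap β x) :=
  Completion.map_coe (uniformContinuous_preMap β) x

theorem norm_mapFun_le (β : B →⋆ₙₐ[ℂ] B) : ∀ x, ‖mapFun β x‖ ≤ ‖x‖ :=
  ind (isClosed_le (continuous_mapFun β).norm continuous_norm) fun x => by
    rw [mapFun_ofPre, norm_ofPre, norm_ofPre]
    exact maxCStarSeminorm_map_le β x

theorem mapFun_star_mul_self (β : B →⋆ₙₐ[ℂ] B) :
    ∀ x, mapFun β (star x * x) = star (mapFun β x) * mapFun β x := by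
  have hc := continuous_mapFun β
  refine ind (isClosed_eq (hc.comp (continuous_star.mul continuous_id)) (hc.star.mul hc)) fun x => ?_
  rw [← ofPre_star, ← ofPre_mul, mapFun_ofPre, mapFun_ofPre, ← ofPre_star, ← ofPre_mul]
  congr 1
  exact (map_mul β (star x) x).trans (congrArg (· * β x) (map_star β x))

/-- The extension of a `*`-endomorphism to the enveloping `C*`-algebra. -/
noncomputable def map (β : B →⋆ₙₐ[ℂ] B) : EnvelopingCStarAlgebra B →L[ℂ] EnvelopingCStarAlgebra B :=
  LinearMap.mkContinuous
    { toFun := mapFun β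
      map_add' := by
        have hc := continuous_mapFun β
        refine ind₂ (isClosed_eq (hc.comp (continuous_fst.add continuous_snd))
          ((hc.comp continuous_fst).add (hc.comp continuous_snd))) fun x y => ?_
        rw [← ofPre_add, mapFun_ofPre, mapFun_ofPre, mapFun_ofPre, ← ofPre_add]
        exact congrArg ofPre (map_add β x y)
      map_smul' := fun c => by
        have hc := continuous_mapFun β
        refine ind (isClosed_eq (hc.comp (continuous_id.const_smul c)) (hc.const_smul c))
          fun x => ?_
        rw [← ofPre_smul, mapFun_ofPre, mapFun_ofPre]
        exact (congrArg ofPre (map_smul β c x)).trans (ofPre_smul c _) }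
    1 fun x => by
      rw [one_mul]
      exact norm_mapFun_le β x

theorem map_apply (β : B →⋆ₙₐ[ℂ] B) (x : EnvelopingCStarAlgebra B) : map β x = mapFun β x := rfl

theorem map_nonneg [StarModule ℂ B] [IsScalarTower ℂ B B] [SMulCommClass ℂ B B]
    (β : B →⋆ₙₐ[ℂ] B) {x : EnvelopingCStarAlgebra B} (hx : 0 ≤ x) : 0 ≤ map β x := by
  obtain ⟨y, rfl⟩ := CStarAlgebra.nonneg_iff_eq_star_mul_self.1 hx
  rw [map_apply, mapFun_star_mul_self]
  exact star_mul_self_nonneg _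

end EnvelopingCStarAlgebra

end EnvelopingMap

section Gauge

variable {r : ℕ} {A D : Type*} {M : Fin r → Matrix A A ℤ} {δ : D → A}

variable [Finite A] {h1 : CondH1 M}

namespace Alg0

/-- The class of an expression. -/
def mk (h1 : CondH1 M) (x : PreAlg M δ) : Alg0 M δ h1 := Quot.mk _ x

theorem mk_sum (L : List (PreAlg M δ)) : mk h1 (PreAlg.sum L) = (L.map (mk h1)).sum := by
  induction L with
  | nil => rfl
  | cons x L ih =>
    rw [List.map_cons, List.sum_cons, ← ih]
    rfl

theorem gen_eq_sum (j : Fin r) (a : A) (u v : DWord M δ) (hu : u.t = a) (hv : v.t = a)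
    [Fintype {w : Word M (Pi.single j 1) // w.o = a}] :
    gen h1 u v (hu.trans hv.symm) = ∑ w : {w : Word M (Pi.single j 1) // w.o = a},
      gen h1 (u.mul h1 w.1 (hu.trans w.2.symm)) (v.mul h1 w.1 (hv.trans w.2.symm))
        ((u.mul_t h1 _ _).trans (v.mul_t h1 _ _).symm) := by
  refine (Quot.sound (PreAlg.Rel.gen_ext j a u v hu hv)).trans ?_
  change mk h1 (PreAlg.extSum h1 j a u v hu hv) = _
  unfold PreAlg.extSum
  rw [mk_sum, List.map_map]
  refine (Finset.sum_map_toList _ _).trans ?_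
  refine Finset.sum_congr (Finset.ext fun _ => by simp) fun _ _ => rfl

theorem gen_mul_gen_of_ne {u v : DWord M δ} (hu : u.shape = 0) (hv : v.shape = 0) (h : u ≠ v) :
    gen h1 u u rfl * gen h1 v v rfl = 0 := Quot.sound (.gen_orth _ _ hu hv h)

/-- The factor by which the gauge action multiplies `s_{u,v}`. -/
noncomputable def gaugeCoeff (j : Fin r) (z : Circle) (u v : DWord M δ) : ℂ :=
  ((z ^ ((u.shape j : ℤ) - v.shape j) : Circle) : ℂ)

omit [Finite A] in
theorem gaugeCoeff_mul (j : Fin r) (z : Circle) (u v w : DWord M δ) :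
    gaugeCoeff j z u v * gaugeCoeff j z v w = gaugeCoeff j z u w := by
  unfold gaugeCoeff
  rw [← Circle.coe_mul, ← zpow_add, sub_add_sub_cancel]

omit [Finite A] in
theorem star_gaugeCoeff (j : Fin r) (z : Circle) (u v : DWord M δ) :
    star (gaugeCoeff j z u v) = gaugeCoeff j z v u := by
  unfold gaugeCoeff
  rw [RCLike.star_def, ← Circle.coe_inv_eq_conj, ← zpow_neg, neg_sub]

/-- The gauge action on expressions, with values in the algebra. -/
noncomputable def gaugeEval (h1 : CondH1 M) (j : Fin r) (z : Circle) : PreAlg M δ → Alg0 M δ h1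
  | .gen u v h => gaugeCoeff j z u v • gen h1 u v h
  | .zero => 0
  | .add x y => gaugeEval h1 j z x + gaugeEval h1 j z y
  | .smul c x => c • gaugeEval h1 j z x
  | .mul x y => gaugeEval h1 j z x * gaugeEval h1 j z y

theorem gaugeEval_sum (j : Fin r) (z : Circle) (L : List (PreAlg M δ)) :
    gaugeEval h1 j z (PreAlg.sum L) = (L.map (gaugeEval h1 j z)).sum := by
  induction L with
  | nil => rfl
  | cons x L ih =>
    rw [List.map_cons, List.sum_cons, ← ih]
    rfl

theorem gaugeEval_eq_of_rel (j : Fin r) (z : Circle) {x y : PreAlg M δ} (h : PreAlg.Rel h1 x y) :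
    gaugeEval h1 j z x = gaugeEval h1 j z y := by
  induction h with
  | refl x => rfl
  | symm _ ih => exact ih.symm
  | trans _ _ ih ih' => exact ih.trans ih'
  | add_congr _ _ ih ih' => exact congrArg₂ (· + ·) ih ih'
  | smul_congr c _ ih => exact congrArg (c • ·) ih
  | mul_congr _ _ ih ih' => exact congrArg₂ (· * ·) ih ih'
  | add_assoc => exact add_assoc _ _ _
  | add_comm => exact add_comm _ _
  | zero_add => exact zero_add _
  | smul_add => exact smul_add _ _ _
  | add_smul => exact add_smul _ _ _
  | mul_smul => exact mul_smul _ _ _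
  | one_smul => exact one_smul _ _
  | zero_smul => exact zero_smul _ _
  | mul_assoc => exact mul_assoc _ _ _
  | left_distrib => exact mul_add _ _ _
  | right_distrib => exact add_mul _ _ _
  | smul_mul => exact smul_mul_assoc _ _ _
  | mul_smul_comm => exact mul_smul_comm _ _ _
  | gen_mul u v w h h' =>
    simp only [gaugeEval]
    rw [smul_mul_smul_comm, gaugeCoeff_mul, gen_mul_gen]
  | gen_ext k a u v hu hv =>
    unfold PreAlg.extSum
    rw [gaugeEval_sum, List.map_map]
    let _ : Fintype {w : Word M (Pi.single k 1) // w.o = a} := Fintype.ofFinite _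
    refine Eq.trans ?_ (Finset.sum_map_toList _ _).symm
    simp only [gaugeEval]
    rw [gen_eq_sum k a u v hu hv, Finset.smul_sum]
    refine Finset.sum_congr rfl fun w _ => ?_
    have : gaugeCoeff j z u v = gaugeCoeff j z (u.mul h1 w.1 (hu.trans w.2.symm))
        (v.mul h1 w.1 (hv.trans w.2.symm)) := by
      simp [gaugeCoeff, DWord.mul]
    rw [this]
    rfl
  | gen_orth u v hu hv h =>
    simp only [gaugeEval]
    rw [smul_mul_smul_comm, gen_mul_gen_of_ne hu hv h, smul_zero]

theorem gaugeEval_conj (j : Fin r) (z : Circle) (x : PreAlg M δ) :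
    gaugeEval h1 j z x.conj = star (gaugeEval h1 j z x) := by
  induction x with
  | gen u v h =>
    simp only [PreAlg.conj, gaugeEval]
    rw [star_smul, star_gaugeCoeff, star_gen]
  | zero => exact (star_zero _).symm
  | add x y ihx ihy => simp only [PreAlg.conj, gaugeEval, ihx, ihy, star_add]
  | smul c x ih => simp only [PreAlg.conj, gaugeEval, ih, star_smul]
  | mul x y ihx ihy => simp only [PreAlg.conj, gaugeEval, ihx, ihy, star_mul]

/-- The gauge action of the `j`-th coordinate circle. -/
noncomputable def gauge (h1 : CondH1 M) (j : Fin r) (z : Circle) : Alg0 M δ h1 →⋆ₙₐ[ℂ] Alg0 M δ h1 where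
  toFun := Quot.lift (gaugeEval h1 j z) fun _ _ => gaugeEval_eq_of_rel j z
  map_smul' := by rintro c ⟨x⟩; rfl
  map_zero' := rfl
  map_add' := by rintro ⟨x⟩ ⟨y⟩; rfl
  map_mul' := by rintro ⟨x⟩ ⟨y⟩; rfl
  map_star' := by rintro ⟨x⟩; exact gaugeEval_conj j z x

theorem gauge_gen (j : Fin r) (z : Circle) (u v : DWord M δ) (h : u.t = v.t) :
    gauge h1 j z (gen h1 u v h) = gaugeCoeff j z u v • gen h1 u v h := rfl

end Alg0

namespace HigherRankCK

open EnvelopingCStarAlgebra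

/-- The canonical map of the algebra of generators and relations into its enveloping algebra. -/
noncomputable def ofAlg (x : Alg0 M δ h1) : HigherRankCK M δ h1 :=
  ofPre (x : PreEnvelope (Alg0 M δ h1))

theorem ofAlg_zero : ofAlg (0 : Alg0 M δ h1) = 0 := rfl

theorem ofAlg_add (x y : Alg0 M δ h1) : ofAlg (x + y) = ofAlg x + ofAlg y := ofPre_add _ _

theorem ofAlg_smul (c : ℂ) (x : Alg0 M δ h1) : ofAlg (c • x) = c • ofAlg x := ofPre_smul c _

theorem ofAlg_mul (x y : Alg0 M δ h1) : ofAlg (x * y) = ofAlg x * ofAlg y := ofPre_mul _ _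

theorem ofAlg_star (x : Alg0 M δ h1) : ofAlg (star x) = star (ofAlg x) := ofPre_star _

theorem ofAlg_sum {ι : Type*} (s : Finset ι) (f : ι → Alg0 M δ h1) :
    ofAlg (∑ i ∈ s, f i) = ∑ i ∈ s, ofAlg (f i) :=
  map_sum (⟨⟨ofAlg, ofAlg_zero⟩, ofAlg_add⟩ : Alg0 M δ h1 →+ HigherRankCK M δ h1) f s

theorem map_ofAlg (β : Alg0 M δ h1 →⋆ₙₐ[ℂ] Alg0 M δ h1) (x : Alg0 M δ h1) :
    map β (ofAlg x) = ofAlg (β x) := mapFun_ofPre β x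

open Classical in
/-- The canonical generators of the higher rank Cuntz-Krieger algebra. -/
noncomputable def family (M : Fin r → Matrix A A ℤ) (δ : D → A) (h1 : CondH1 M) :
    CKFamily M δ h1 (HigherRankCK M δ h1) where
  S u v := if h : u.t = v.t then ofAlg (Alg0.gen h1 u v h) else 0
  S_of_ne h := dif_neg h
  star_S u v := by
    by_cases h : u.t = v.t
    · rw [dif_pos h, dif_pos h.symm, ← ofAlg_star, Alg0.star_gen]
    · rw [dif_neg h, dif_neg (Ne.symm h), star_zero]
  S_mul_S {u v w} h := by
    by_cases h' : u.t = v.t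
    · rw [dif_pos h', dif_pos h, dif_pos (h'.trans h), ← ofAlg_mul, Alg0.gen_mul_gen]
    · rw [dif_neg h', zero_mul, dif_neg fun h'' => h' (h''.trans h.symm)]
  S_eq_sum j a u v hu hv _ := by
    rw [dif_pos (hu.trans hv.symm), Alg0.gen_eq_sum j a u v hu hv, ofAlg_sum]
    refine Finset.sum_congr rfl fun w _ => ?_
    rw [dif_pos]
  orth hu hv h := by
    rw [dif_pos rfl, dif_pos rfl, ← ofAlg_mul, Alg0.gen_mul_gen_of_ne hu hv h, ofAlg_zero]

theorem family_S {u v : DWord M δ} (h : u.t = v.t) :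
    (family M δ h1).S u v = ofAlg (Alg0.gen h1 u v h) := dif_pos h

theorem dense_fullSpan : Dense ((family M δ h1).fullSpan : Set (HigherRankCK M δ h1)) := by
  refine isDenseInducing_ofPre.dense.mono ?_
  rintro _ ⟨⟨x⟩, rfl⟩
  change ofAlg (Alg0.mk h1 x) ∈ (family M δ h1).fullSpan
  induction x with
  | gen u v h =>
    change ofAlg (Alg0.gen h1 u v h) ∈ _
    rw [← family_S h]
    exact (family M δ h1).S_mem_fullSpan u v
  | zero => exact Submodule.zero_mem _
  | add x y ihx ihy =>
    change ofAlg (Alg0.mk h1 x + Alg0.mk h1 y) ∈ _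
    rw [ofAlg_add]
    exact Submodule.add_mem _ ihx ihy
  | smul c x ih =>
    change ofAlg (c • Alg0.mk h1 x) ∈ _
    rw [ofAlg_smul]
    exact Submodule.smul_mem _ c ih
  | mul x y ihx ihy =>
    change ofAlg (Alg0.mk h1 x * Alg0.mk h1 y) ∈ _
    rw [ofAlg_mul]
    exact (family M δ h1).mul_mem_fullSpan ihx ihy

theorem map_gauge_S (j : Fin r) (z : Circle) (u v : DWord M δ) :
    map (Alg0.gauge h1 j z) ((family M δ h1).S u v) =
      Alg0.gaugeCoeff j z u v • (family M δ h1).S u v := by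
  by_cases h : u.t = v.t
  · rw [family_S h, map_ofAlg, Alg0.gauge_gen, ofAlg_smul]
  · rw [(family M δ h1).S_of_ne h, map_zero, smul_zero]

end HigherRankCK

end Gauge

theorem proposition5p9 {r : ℕ} (hr : 1 ≤ r) {A D : Type*} [Finite A] [Countable D] [Nonempty D]
    (M : Fin r → Matrix A A ℤ) (δ : D → A)
    (h0 : CondH0 M) (h1 : CondH1 M) (h2 : CondH2 M) (h3 : CondH3 M) :
    IsPurelyInfinite (HigherRankCK M δ h1) := by
  obtain ⟨Φ, hp, hf, hs, hs'⟩ := (HigherRankCK.family M δ h1).exists_expectation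
    HigherRankCK.dense_fullSpan
    (fun j t => EnvelopingCStarAlgebra.map (Alg0.gauge h1 j (Circle.exp t)))
    (fun j t => EnvelopingCStarAlgebra.norm_mapFun_le _)
    (fun j t x hx => EnvelopingCStarAlgebra.map_nonneg _ hx) (fun j t u v => by
      rw [HigherRankCK.map_gauge_S, Alg0.gaugeCoeff, Circle.coe_zpow, Circle.coe_exp,
        ← Complex.exp_int_mul]
      congr 2
      push_cast
      ring)
  exact (HigherRankCK.family M δ h1).isPurelyInfinite hr h0 h2 h3 HigherRankCK.dense_fullSpan
    Φ hp hf hs hs'
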